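/- **Setting.** Let $C$ be a simple closed curve of finite total length $L>0$ in the plane, described by its arc-length parameter $\lambda\mapsto c(\lambda)$ (extended with period $L$), which is non-differentiable at at most finitely many points. Let $\gamma$ be a conformal transformation of the open unit disk onto the interior of $C$, extended to a continuous injective map of the closed unit disk which maps the unit circle onto $C$. **Real functions.** A real function $g$ of a real parameter of period $T$ has a *non-integrable singularity* at $x$ if it is integrable on no neighbourhood of $x$; it is *locally integrable almost everywhere* if it has finitely many such points per period and is integrable on every closed interval that contains none of them. It *diverges to infinity* at $x$ if $|g|\to\infty$ at $x$ from at least one side. **Inner analytic functions.** These are the functions $w$ analytic in the open unit disk. The angular derivative of $w$ is $i z\,w'(z)$, and its angular primitive is $-i\int_0^z \frac{w(z')-w(0)}{z'}\,dz'$. A point $\zeta$ of the unit circle is a *hard singularity* of $w$ if $w$ has no finite limit at $\zeta$ from within the open disk; it is *borderline hard* if it is a hard singularity of $w$ but not of the angular primitive of $w$; a hard singularity of $w$ has *degree of hardness* $n$ if it is a borderline hard singularity of the $n$-th angular primitive of $w$. **Corresponding inner analytic function.** For an integrable real function $F$ on the unit circle with Fourier coefficients $\alpha_k=\frac1\pi\int_{-\pi}^{\pi}F(\theta)\cos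 k\theta\,d\theta$ and $\beta_k=\frac1\pi\int_{-\pi}^{\pi}F(\theta)\sin k\theta\,d\theta$, put $w_F(z)=\frac{\alpha_0}{2}+\sum_{k\ge1}(\alpha_k-i\beta_k)z^k$. Let $g$ be a real function on the unit circle that is locally integrable almost everywhere, with set $S$ of non-integrable singularities. A *piecewise primitive* on the circle is a $2\pi$-periodic function which is a primitive on every closed interval that does not meet $S$. An inner analytic function $w$ *corresponds to* $g$ if, for some $n\ge0$, it is the $n$-th angular derivative of $w_F$, where $F$ is integrable on the circle and is obtained from $g$ by taking $n$ successive piecewise primitives (for integrable $g$ one may take $n=0$, $w=w_g$). **Theorem.** Let $f$ be a real function on $C$ such that 1. $\lambda\mapsto f(c(\lambda))$ is locally integrable almost everywhere on $C$; 2. the function $\theta\mapsto f(\gamma(e^{i\theta}))$ on the unit circle has a corresponding inner analytic function $w$ with at most finitely many hard singularities on the unit circle; 3. each hard singularity of $w$ has a finite degree of hardness; 4. $f$ does not diverge to infinity at any point where $C$ is non-differentiable. Then there is a real function $u$ which is harmonic in the interior of $C$ and satisfies $u=f$ almost everywhere on $C$ with respect to arc length, that is: for almost every $\lambda$, if $\theta$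 is such that $\gamma(e^{i\theta})=c(\lambda)$, then $\lim_{\rho\to1^-}u(\gamma(\rho e^{i\theta}))=f(c(\lambda))$. -/

import Mathlib

open Set Filter Topology MeasureTheory

noncomputable section

namespace PlaneDirichlet

/-! ### The curve, its interior and the conformal transformation -/

/-- `c` is a simple closed curve of finite total length `L > 0` in the plane, described by its
arc-length parameter (extended periodically to the real line). Continuity of `c` follows from
`unit_speed`. -/
structure IsSimpleClosedCurve (c : ℝ → ℂ) (L : ℝ) : Prop where
  length_pos : 0 < L
  periodic : Function.Periodic c L
  simple : InjOn c (Ico 0 L)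
  unit_speed : HasUnitSpeedOn c univ

/-- The interior of a closed curve with trace `C`: the points off `C` whose connected component
in the complement of `C` is bounded. -/
def inside (C : Set ℂ) : Set ℂ :=
  {z | z ∈ Cᶜ ∧ Bornology.IsBounded (connectedComponentIn Cᶜ z)}

/-- `γ` is a conformal transformation of the open unit disk onto the interior of the curve with
trace `C`, together with its continuous invertible extension mapping the unit circle onto `C`. -/
structure IsConformalTransformation (γ : ℂ → ℂ) (C : Set ℂ) : Prop where
  differentiableOn : DifferentiableOn ℂ γ (Metric.ball 0 1)
  continuousOn : ContinuousOn γ (Metric.closedBall 0 1)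
  injOn : InjOn γ (Metric.closedBall 0 1)
  image_ball : γ '' Metric.ball 0 1 = inside C
  image_sphere : γ '' Metric.sphere 0 1 = C

/-- The point of the unit circle at angle `θ`. -/
def circlePoint (θ : ℝ) : ℂ := Complex.exp (θ * Complex.I)

/-! ### Real functions of a periodic real parameter -/

/-- The points where `g` has a non-integrable singularity: `g` is not integrable on any
neighbourhood of the point. -/
def nonIntegrableSet (g : ℝ → ℝ) : Set ℝ :=
  {x | ¬ IntegrableAtFilter g (𝓝 x) volume}

/-- A real function `g` of a parameter of period `T` is locally integrable almost everywhere: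
it has finitely many non-integrable singularities per period, and it is integrable on every closed
interval that contains none of them. -/
def LocallyIntegrableAE (g : ℝ → ℝ) (T : ℝ) : Prop :=
  (nonIntegrableSet g ∩ Ico 0 T).Finite ∧
    ∀ a b : ℝ, Disjoint (Icc a b) (nonIntegrableSet g) → IntegrableOn g (Icc a b) volume

/-- `g` diverges to infinity at `x` (from at least one of the two sides). -/
def DivergesAt (g : ℝ → ℝ) (x : ℝ) : Prop :=
  Tendsto (fun y => |g y|) (𝓝[<] x) atTop ∨ Tendsto (fun y => |g y|) (𝓝[>] x) atTop

/-! ### Inner analytic functions -/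

/-- The angular derivative `i z w'(z)`. -/
def angularDeriv (w : ℂ → ℂ) : ℂ → ℂ :=
  fun z => Complex.I * z * deriv w z

/-- The angular primitive `-i ∫_0^z (w(z') - w(0)) / z' dz'`, with the integral taken along the
segment `z' = t z`, `0 ≤ t ≤ 1`. -/
def angularPrimitive (w : ℂ → ℂ) : ℂ → ℂ :=
  fun z => -Complex.I * ∫ t in (0 : ℝ)..1, (w ((t : ℂ) * z) - w 0) / (t : ℂ)

/-- An inner analytic function has a hard singularity at the point `ζ` of the unit circle if it
has no finite limit at `ζ` from within the open unit disk. -/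
def IsHardSingularity (w : ℂ → ℂ) (ζ : ℂ) : Prop :=
  ‖ζ‖ = 1 ∧ ¬ ∃ a : ℂ, Tendsto w (𝓝[Metric.ball 0 1] ζ) (𝓝 a)

/-- A hard singularity that a single angular integration makes soft. -/
def IsBorderlineHard (w : ℂ → ℂ) (ζ : ℂ) : Prop :=
  IsHardSingularity w ζ ∧ ¬ IsHardSingularity (angularPrimitive w) ζ

/-- The singularity of `w` at `ζ` is hard with degree of hardness `n`: after `n` angular
integrations it is borderline hard. -/
def HasDegreeOfHardness (w : ℂ → ℂ) (ζ : ℂ) (n : ℕ) : Prop :=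
  IsHardSingularity w ζ ∧ IsBorderlineHard (angularPrimitive^[n] w) ζ

/-! ### The inner analytic function corresponding to a real function on the unit circle -/

/-- Fourier coefficient `α_k`. -/
def fourierCos (F : ℝ → ℝ) (k : ℕ) : ℝ :=
  (1 / Real.pi) * ∫ θ in (-Real.pi)..Real.pi, F θ * Real.cos (k * θ)

/-- Fourier coefficient `β_k`. -/
def fourierSin (F : ℝ → ℝ) (k : ℕ) : ℝ :=
  (1 / Real.pi) * ∫ θ in (-Real.pi)..Real.pi, F θ * Real.sin (k * θ)

/-- Taylor coefficients `c_0 = α_0 / 2`, `c_k = α_k - i β_k`. -/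
def taylorCoeff (F : ℝ → ℝ) (k : ℕ) : ℂ :=
  if k = 0 then (fourierCos F 0 / 2 : ℝ)
  else (fourierCos F k : ℂ) - Complex.I * (fourierSin F k : ℂ)

/-- The inner analytic function `∑ c_k z^k` of an integrable real function on the unit circle. -/
def innerOfIntegrable (F : ℝ → ℝ) (z : ℂ) : ℂ :=
  ∑' k : ℕ, taylorCoeff F k * z ^ k

/-- `H` is a piecewise primitive of `G` on the unit circle with the singular points `S` removed:
a function on the circle which is a primitive of `G` on every closed interval that does not meet
`S`. The constants of integration on the sections between points of `S` are independent. -/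
def IsPiecewisePrimitive (S : Set ℝ) (G H : ℝ → ℝ) : Prop :=
  Function.Periodic H (2 * Real.pi) ∧
    ∀ a b : ℝ, a ≤ b → Disjoint (Icc a b) S →
      IntervalIntegrable G volume a b ∧ H b - H a = ∫ x in a..b, G x

/-- `w` is an inner analytic function corresponding to the real function `g` on the unit circle,
`g` being locally integrable almost everywhere: for some `n`, the `n`-th angular derivative of the
inner analytic function of an `n`-th piecewise primitive of `g` that is integrable on the whole
circle. For integrable `g` one has `n = 0`, and `w` is the function with the Taylor coefficients
given by the Fourier coefficients of `g`. -/
def IsCorrespondingInner (w : ℂ → ℂ) (g : ℝ → ℝ) : Prop :=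
  LocallyIntegrableAE g (2 * Real.pi) ∧
    ∃ (n : ℕ) (G : ℕ → ℝ → ℝ), G 0 = g ∧
      (∀ k < n, IsPiecewisePrimitive (nonIntegrableSet g) (G k) (G (k + 1))) ∧
      IntervalIntegrable (G n) volume (-Real.pi) Real.pi ∧
      EqOn w (angularDeriv^[n] (innerOfIntegrable (G n))) (Metric.ball 0 1)

end PlaneDirichlet

end

namespace PlaneDirichlet

/-! ### Points of the unit circle -/

/-! Write `g θ = f (γ (circlePoint θ))`. The solution is the real part of `w`, carried to the
interior of the curve by the inverse of `γ` (`exists_harmonicOnNhd_comp_eq`). Two facts about the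
boundary remain: the real part of `w` has radial limit `g θ` for almost every angle, and "almost
every angle" implies "almost every arc length".

The radial limits (`tendsto_re_of_isCorrespondingInner`). As `w` is the `n`-th angular derivative of
the Herglotz integral of an integrable `F`, its real part is the integral of `F (θ + s)` against
`reKernel n r s`, the real part of the `n`-th angular derivative of the Herglotz kernel. These
kernels vanish uniformly away from `s = 0` as `r → 1`, so only values of `F` near `θ` count. If `θ`
is not a singular point, `F` is there an honest `n`-fold primitive of `g`; `n` integrations by
parts, whose boundary terms vanish in the limit, leave the Poisson integral of `g`. One more puts
the nonnegative peak kernel `s * reKernel 1 r s` against a difference quotient of the indefinite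
integral of `g`. This is Fatou's theorem at every nonsingular point where that integral has
derivative `g θ`, hence almost everywhere, since the singular set is countable.

The passage to arc length (`ae_forall_of_ae`) is the theorem of F. and M. Riesz. By the maximum
principle the images of the circles `|z| = r` have length at most `L`. The derivative of `γ` has no
zeros, so it is the square of some `q`, and the bound on lengths puts `q` in the Hardy space `H²`.
Its `L²` boundary function `v` gives an absolutely continuous measure with density `|v|²` that
dominates the variation of `γ` on arcs (`exists_measure_eVariationOn_le`). A covering argument then
shows that a null set of angles corresponds to a null set of arc lengths
(`volume_preimage_eq_zero`). -/

theorem norm_circlePoint (θ : ℝ) : ‖circlePoint θ‖ = 1 := Complex.norm_exp_ofReal_mul_I θ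

theorem circlePoint_add (a b : ℝ) : circlePoint (a + b) = circlePoint a * circlePoint b := by
  simp [circlePoint, add_mul, Complex.exp_add]

theorem hasDerivAt_circlePoint (θ : ℝ) :
    HasDerivAt circlePoint (Complex.I * circlePoint θ) θ := by
  have h : HasDerivAt (fun t : ℝ => (t : ℂ) * Complex.I) (1 * Complex.I) θ :=
    (Complex.ofRealCLM.hasDerivAt (x := θ)).mul_const Complex.I
  have h2 := h.cexp
  rw [one_mul, mul_comm] at h2
  exact h2

theorem differentiable_circlePoint : Differentiable ℝ circlePoint :=
  fun θ => (hasDerivAt_circlePoint θ).differentiableAt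

theorem continuous_circlePoint : Continuous circlePoint := differentiable_circlePoint.continuous

theorem circlePoint_periodic : Function.Periodic circlePoint (2 * Real.pi) := by
  intro θ
  simp [circlePoint, add_mul, Complex.exp_add, Complex.exp_two_pi_mul_I]

theorem circlePoint_re (θ : ℝ) : (circlePoint θ).re = Real.cos θ := by
  simp [circlePoint, Complex.exp_ofReal_mul_I_re]

theorem circlePoint_im (θ : ℝ) : (circlePoint θ).im = Real.sin θ := by
  simp [circlePoint, Complex.exp_ofReal_mul_I_im]

theorem circlePoint_ne_one {s : ℝ} (h0 : s ≠ 0) (h1 : |s| ≤ Real.pi) : circlePoint s ≠ 1 := by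
  intro h
  have h2 : Real.cos s = 1 := by rw [← circlePoint_re, h, Complex.one_re]
  have hpi := Real.pi_pos
  rw [abs_le] at h1
  exact h0 ((Real.cos_eq_one_iff_of_lt_of_lt (by linarith) (by linarith)).1 h2)

theorem ofReal_mul_circlePoint_mem_ball {r : ℝ} (h : |r| < 1) (θ : ℝ) :
    (r : ℂ) * circlePoint θ ∈ Metric.ball (0 : ℂ) 1 := by
  simp [norm_circlePoint, h]

/-! ### The Herglotz kernel and its angular derivatives -/

/-- The angular derivatives of the Herglotz kernel `(1 + z) / (1 - z)` of the unit disk. -/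
noncomputable def herglotz (n : ℕ) : ℂ → ℂ := angularDeriv^[n] fun z => (1 + z) / (1 - z)

theorem herglotz_succ (n : ℕ) (z : ℂ) :
    herglotz (n + 1) z = Complex.I * z * deriv (herglotz n) z := by
  simp only [herglotz, Function.iterate_succ_apply', angularDeriv]

theorem analyticOnNhd_herglotz (n : ℕ) : AnalyticOnNhd ℂ (herglotz n) {1}ᶜ := by
  induction n with
  | zero =>
    intro z hz
    have hz' : (1 : ℂ) - z ≠ 0 := sub_ne_zero.2 fun h => hz h.symm
    exact (analyticAt_const.add analyticAt_id).div (analyticAt_const.sub analyticAt_id) hz'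
  | succ n ih =>
    have h : herglotz (n + 1) = fun z => Complex.I * z * deriv (herglotz n) z :=
      funext (herglotz_succ n)
    rw [h]
    exact (analyticOnNhd_const.mul analyticOnNhd_id).mul ih.deriv

theorem ne_one_of_mem_ball {z : ℂ} (hz : z ∈ Metric.ball (0 : ℂ) 1) : z ≠ 1 := by
  rintro rfl
  simp at hz

/-- Since `z * circlePoint s` has derivative `i` times itself in `s`, the operator `i z d/dz` is
differentiation along circles about the origin. -/
theorem hasDerivAt_herglotz_mul_circlePoint (n : ℕ) (z : ℂ) (s : ℝ) (h : z * circlePoint s ≠ 1) :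
    HasDerivAt (fun s => herglotz n (z * circlePoint s)) (herglotz (n + 1) (z * circlePoint s))
      s := by
  have h1 : HasDerivAt (herglotz n) (deriv (herglotz n) (z * circlePoint s)) (z * circlePoint s) :=
    (analyticOnNhd_herglotz n _ h).differentiableAt.hasDerivAt
  have h2 := (hasDerivAt_circlePoint s).const_mul z
  refine (HasDerivAt.comp s h1 h2).congr_deriv ?_
  rw [herglotz_succ]
  ring

/-- On the unit circle the Herglotz kernel and its angular derivatives are purely imaginary. -/
theorem herglotz_circlePoint_re (n : ℕ) (s : ℝ) (h : circlePoint s ≠ 1) :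
    (herglotz n (circlePoint s)).re = 0 := by
  induction n generalizing s with
  | zero =>
    -- The numerator of the real part of `(1 + z) / (1 - z)` is `1 - |z|²`.
    have h1 : (circlePoint s).re ^ 2 + (circlePoint s).im ^ 2 = 1 := by
      rw [circlePoint_re, circlePoint_im, Real.cos_sq_add_sin_sq]
    simp only [herglotz, Function.iterate_zero, id, Complex.div_re, Complex.add_re, Complex.one_re,
      Complex.sub_re, Complex.add_im, Complex.one_im, Complex.sub_im]
    rw [← add_div]
    convert zero_div _
    nlinarith
  | succ n ih =>
    have hd := hasDerivAt_herglotz_mul_circlePoint n 1 s (by rwa [one_mul])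
    simp only [one_mul] at hd
    have hre := Complex.reCLM.hasFDerivAt.comp_hasDerivAt s hd
    -- The real part is zero on a whole neighbourhood of `s`, so its angular derivative is zero too.
    have hev : (fun t => (herglotz n (circlePoint t)).re) =ᶠ[𝓝 s] fun _ => (0 : ℝ) := by
      have : ∀ᶠ t in 𝓝 s, circlePoint t ≠ 1 :=
        continuous_circlePoint.continuousAt.eventually_ne h
      filter_upwards [this] with t ht using ih t ht
    exact hre.unique ((hasDerivAt_const s (0 : ℝ)).congr_of_eventuallyEq hev)

/-- The real kernel `Re K_n (r e^{-is})`; for `n = 0` it is the Poisson kernel. -/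
noncomputable def reKernel (n : ℕ) (r s : ℝ) : ℝ := (herglotz n (r * circlePoint (-s))).re

theorem mul_circlePoint_ne_one {r : ℝ} (h : |r| < 1) (s : ℝ) : (r : ℂ) * circlePoint s ≠ 1 :=
  ne_one_of_mem_ball (ofReal_mul_circlePoint_mem_ball h s)

/-- The sign comes from the argument `-s` in the kernel; it cancels the sign of each integration by
parts. -/
theorem hasDerivAt_reKernel (n : ℕ) {r : ℝ} (h : |r| < 1) (s : ℝ) :
    HasDerivAt (reKernel n r) (-reKernel (n + 1) r s) s := by
  have h1 := hasDerivAt_herglotz_mul_circlePoint n r (-s) (mul_circlePoint_ne_one h _)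
  have h2 := h1.scomp s (hasDerivAt_neg s)
  refine (Complex.reCLM.hasFDerivAt.comp_hasDerivAt s h2).congr_deriv ?_
  simp [reKernel]

theorem continuous_reKernel (n : ℕ) {r : ℝ} (h : |r| < 1) : Continuous (reKernel n r) :=
  continuous_iff_continuousAt.2 fun s => (hasDerivAt_reKernel n h s).continuousAt

theorem reKernel_periodic (n : ℕ) (r : ℝ) : Function.Periodic (reKernel n r) (2 * Real.pi) := by
  intro s
  have : circlePoint (-(s + 2 * Real.pi)) = circlePoint (-s) := by
    rw [neg_add, ← sub_eq_add_neg, circlePoint_periodic.sub_eq]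
  simp only [reKernel, this]

theorem reKernel_neg_zero (r s : ℝ) : reKernel 0 r (-s) = reKernel 0 r s := by
  simp only [reKernel, herglotz, Function.iterate_zero, id, neg_neg, Complex.div_re, Complex.mul_re,
    Complex.mul_im, Complex.add_re, Complex.one_re, Complex.sub_re, Complex.add_im, Complex.one_im,
    Complex.sub_im, Complex.normSq_apply, circlePoint_re, circlePoint_im, Real.cos_neg,
    Real.sin_neg, Complex.ofReal_re, Complex.ofReal_im]
  ring

/-- `s Q_1(r, s) ≥ 0`: the Poisson kernel decreases on `[0, π]`. -/
theorem mul_reKernel_one_nonneg {r s : ℝ} (h0 : 0 ≤ r) (h1 : r < 1) (hs : |s| ≤ Real.pi) :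
    0 ≤ s * reKernel 1 r s := by
  set z : ℂ := r * circlePoint (-s) with hz
  have hr : |r| < 1 := by rwa [abs_of_nonneg h0]
  have hz1 : (1 : ℂ) - z ≠ 0 := sub_ne_zero.2 (mul_circlePoint_ne_one hr _).symm
  have hd : HasDerivAt (fun z : ℂ => (1 + z) / (1 - z)) (2 / (1 - z) ^ 2) z := by
    have := ((hasDerivAt_id z).const_add 1).div ((hasDerivAt_id z).const_sub 1) hz1
    refine this.congr_deriv ?_
    simp
    ring
  have hK : herglotz 1 z = Complex.I * z * (2 / (1 - z) ^ 2) := by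
    rw [herglotz_succ, herglotz, Function.iterate_zero, id, hd.deriv]
  have hnz : (starRingEnd ℂ) (1 - z) ≠ 0 := (map_ne_zero _).2 hz1
  -- Expanding by the conjugate isolates a nonnegative real factor; the real part of `i z (1 - conj
  -- z)²` is `r (1 - r²) sin s`.
  have hK2 : herglotz 1 z = ((2 / Complex.normSq (1 - z) ^ 2 : ℝ) : ℂ) *
      (Complex.I * z * (starRingEnd ℂ) (1 - z) ^ 2) := by
    rw [hK]
    push_cast
    rw [Complex.normSq_eq_conj_mul_self]
    field_simp
  have hre : z.re = r * Real.cos s := by simp [hz, circlePoint_re, circlePoint_im]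
  have him : z.im = -(r * Real.sin s) := by simp [hz, circlePoint_re, circlePoint_im]
  have hval : reKernel 1 r s = 2 / Complex.normSq (1 - z) ^ 2 * (r * (1 - r ^ 2) * Real.sin s) := by
    rw [reKernel, ← hz, hK2, Complex.re_ofReal_mul]
    congr 1
    simp [pow_two, hre, him]
    have := Real.sin_sq_add_cos_sq s
    have h2 : Real.cos s ^ 2 = 1 - Real.sin s ^ 2 := by linarith
    ring_nf
    rw [h2]
    ring
  have hss : 0 ≤ s * Real.sin s := by
    rw [abs_le] at hs
    rcases le_total 0 s with h | h
    · exact mul_nonneg h (Real.sin_nonneg_of_nonneg_of_le_pi h hs.2)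
    · exact mul_nonneg_of_nonpos_of_nonpos h (Real.sin_nonpos_of_nonpos_of_neg_pi_le h (by linarith))
  rw [hval]
  have h3 : 0 ≤ 1 - r ^ 2 := by nlinarith
  have : s * (2 / Complex.normSq (1 - z) ^ 2 * (r * (1 - r ^ 2) * Real.sin s)) =
      2 / Complex.normSq (1 - z) ^ 2 * (r * (1 - r ^ 2)) * (s * Real.sin s) := by ring
  rw [this]
  positivity

/-- Away from `s = 0` the kernels tend to zero uniformly as `r → 1`. -/
theorem tendstoUniformlyOn_reKernel (n : ℕ) {δ : ℝ} (hδ : 0 < δ) :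
    TendstoUniformlyOn (reKernel n) 0 (𝓝[<] 1) {s | δ ≤ |s| ∧ |s| ≤ Real.pi} := by
  have hk : IsCompact {s : ℝ | δ ≤ |s| ∧ |s| ≤ Real.pi} := by
    refine (isCompact_Icc (a := -Real.pi) (b := Real.pi)).of_isClosed_subset ?_ ?_
    · exact (isClosed_le continuous_const continuous_abs).inter
        (isClosed_le continuous_abs continuous_const)
    · exact fun s hs => abs_le.1 hs.2
  have hne : ∀ r ∈ Icc (0 : ℝ) 1, ∀ s ∈ {s : ℝ | δ ≤ |s| ∧ |s| ≤ Real.pi},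
      (r : ℂ) * circlePoint (-s) ≠ 1 := by
    intro r hr s hs
    rcases hr.2.lt_or_eq with h | h
    · exact mul_circlePoint_ne_one (by rwa [abs_of_nonneg hr.1]) _
    · rw [h, Complex.ofReal_one, one_mul]
      refine circlePoint_ne_one (neg_ne_zero.2 ?_) (by rw [abs_neg]; exact hs.2)
      exact abs_pos.1 (hδ.trans_le hs.1)
  -- Joint continuity holds up to `r = 1`, where the kernel is zero; compactness in `s` makes the
  -- convergence uniform.
  have hc : ContinuousOn (Function.uncurry (reKernel n))
      (Icc (0 : ℝ) 1 ×ˢ {s : ℝ | δ ≤ |s| ∧ |s| ≤ Real.pi}) := by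
    have h1 : Continuous fun p : ℝ × ℝ => (p.1 : ℂ) * circlePoint (-p.2) :=
      (Complex.continuous_ofReal.comp continuous_fst).mul
        (continuous_circlePoint.comp continuous_snd.neg)
    exact Complex.continuous_re.comp_continuousOn
      ((analyticOnNhd_herglotz n).continuousOn.comp h1.continuousOn
        fun p hp => hne p.1 hp.1 p.2 hp.2)
  rw [Metric.tendstoUniformlyOn_iff]
  intro ε hε
  obtain ⟨v, hv, hv2⟩ := hk.mem_uniformity_of_prod hc (right_mem_Icc.2 zero_le_one)
    (Metric.dist_mem_uniformity hε)
  have hle : 𝓝[<] (1 : ℝ) ≤ 𝓝[Icc 0 1] 1 := by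
    refine nhdsWithin_le_iff.2 ?_
    filter_upwards [Ioo_mem_nhdsLT (zero_lt_one (α := ℝ))] with x hx using ⟨hx.1.le, hx.2.le⟩
  filter_upwards [hle hv] with r hr s hs
  have h1 := hv2 r hr s hs
  have h2 : reKernel n 1 s = 0 := by
    rw [reKernel, Complex.ofReal_one, one_mul]
    have := hne 1 (right_mem_Icc.2 zero_le_one) s hs
    rw [Complex.ofReal_one, one_mul] at this
    exact herglotz_circlePoint_re n _ this
  rw [Pi.zero_apply, dist_comm]
  simpa [h2] using h1

theorem tendsto_reKernel (n : ℕ) {s : ℝ} (h0 : s ≠ 0) (h1 : |s| ≤ Real.pi) :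
    Tendsto (fun r => reKernel n r s) (𝓝[<] 1) (𝓝 0) :=
  (tendstoUniformlyOn_reKernel n (abs_pos.2 h0)).tendsto_at ⟨le_rfl, h1⟩

/-! ### Integral representation of the inner analytic function -/

theorem circlePoint_neg_pow (t : ℝ) (k : ℕ) :
    circlePoint (-t) ^ k = (Real.cos (k * t) : ℂ) - Complex.I * (Real.sin (k * t) : ℂ) := by
  have h : circlePoint (-t) ^ k = circlePoint (-(k * t)) := by
    simp only [circlePoint]
    rw [← Complex.exp_nat_mul]
    push_cast
    ring_nf
  rw [h]
  apply Complex.ext <;> simp [circlePoint_re, circlePoint_im, -Complex.ofReal_cos,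
    -Complex.ofReal_sin]

theorem _root_.IntervalIntegrable.ofReal_mul_continuous {F : ℝ → ℝ} {a b : ℝ}
    (hF : IntervalIntegrable F volume a b) {k : ℝ → ℂ} (hk : Continuous k) :
    IntervalIntegrable (fun t => (F t : ℂ) * k t) volume a b :=
  IntervalIntegrable.mul_continuousOn
    ⟨hF.1.ofReal, hF.2.ofReal⟩ hk.continuousOn

/-- The factors `1` and `2` are the Taylor coefficients of the Herglotz kernel, which prepares the
summation under the integral. -/
theorem taylorCoeff_eq_integral {F : ℝ → ℝ}
    (hF : IntervalIntegrable F volume (-Real.pi) Real.pi) (k : ℕ) :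
    taylorCoeff F k = (1 / (2 * Real.pi) : ℝ) *
      ∫ t in (-Real.pi)..Real.pi, (F t : ℂ) * ((if k = 0 then 1 else 2) * circlePoint (-t) ^ k) := by
  have hpi : (Real.pi : ℂ) ≠ 0 := Complex.ofReal_ne_zero.2 Real.pi_ne_zero
  have hc : IntervalIntegrable (fun t => F t * Real.cos (k * t)) volume (-Real.pi) Real.pi :=
    hF.mul_continuousOn (by fun_prop)
  have hs : IntervalIntegrable (fun t => F t * Real.sin (k * t)) volume (-Real.pi) Real.pi :=
    hF.mul_continuousOn (by fun_prop)
  rcases eq_or_ne k 0 with rfl | hk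
  · simp only [taylorCoeff, fourierCos, if_true, pow_zero, mul_one, Nat.cast_zero, zero_mul,
      Real.cos_zero]
    rw [intervalIntegral.integral_ofReal]
    push_cast
    field_simp
  · have h1 : (∫ t in (-Real.pi)..Real.pi,
        (F t : ℂ) * ((if k = 0 then 1 else 2) * circlePoint (-t) ^ k)) =
        2 * ((∫ t in (-Real.pi)..Real.pi, F t * Real.cos (k * t) : ℝ) : ℂ) -
        2 * Complex.I * ((∫ t in (-Real.pi)..Real.pi, F t * Real.sin (k * t) : ℝ) : ℂ) := by
      rw [← intervalIntegral.integral_ofReal, ← intervalIntegral.integral_ofReal,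
        ← intervalIntegral.integral_const_mul, ← intervalIntegral.integral_const_mul,
        ← intervalIntegral.integral_sub]
      · refine intervalIntegral.integral_congr fun t _ => ?_
        simp only [if_neg hk, circlePoint_neg_pow]
        push_cast
        ring
      · exact IntervalIntegrable.const_mul ⟨hc.1.ofReal, hc.2.ofReal⟩ _
      · exact IntervalIntegrable.const_mul ⟨hs.1.ofReal, hs.2.ofReal⟩ _
    rw [h1]
    simp only [taylorCoeff, fourierCos, fourierSin, if_neg hk]
    push_cast
    field_simp

theorem hasSum_herglotz {z : ℂ} (hz : ‖z‖ < 1) :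
    HasSum (fun k : ℕ => (if k = 0 then 1 else 2) * z ^ k) (herglotz 0 z) := by
  have hz1 : (1 : ℂ) - z ≠ 0 :=
    sub_ne_zero.2 (ne_one_of_mem_ball (mem_ball_zero_iff.2 hz)).symm
  have h1 := (hasSum_geometric_of_norm_lt_one hz).mul_left 2
  have h2 := (hasSum_ite_eq (0 : ℕ) (1 : ℂ))
  have h3 : herglotz 0 z = 2 * (1 - z)⁻¹ - 1 := by
    simp only [herglotz, Function.iterate_zero, id]
    field_simp
    ring
  rw [h3]
  have h4 : (fun k : ℕ => (if k = 0 then 1 else 2) * z ^ k) =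
      fun k : ℕ => 2 * z ^ k - if k = 0 then 1 else 0 := by
    funext k
    rcases eq_or_ne k 0 with rfl | hk
    · norm_num
    · simp [hk]
  rw [h4]
  exact h1.sub h2

/-- The Herglotz formula: the kernel series is summed under the integral, dominated by `|F t| * 2
‖z‖ ^ k`. -/
theorem innerOfIntegrable_eq_integral {F : ℝ → ℝ}
    (hF : IntervalIntegrable F volume (-Real.pi) Real.pi) {z : ℂ} (hz : ‖z‖ < 1) :
    innerOfIntegrable F z = (1 / (2 * Real.pi) : ℝ) *
      ∫ t in (-Real.pi)..Real.pi, (F t : ℂ) * herglotz 0 (z * circlePoint (-t)) := by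
  have hn : ∀ t, ‖z * circlePoint (-t)‖ = ‖z‖ := fun t => by
    rw [norm_mul, norm_circlePoint, mul_one]
  have hsum : HasSum (fun k : ℕ => ∫ t in (-Real.pi)..Real.pi,
      (F t : ℂ) * ((if k = 0 then 1 else 2) * (z * circlePoint (-t)) ^ k))
      (∫ t in (-Real.pi)..Real.pi, (F t : ℂ) * herglotz 0 (z * circlePoint (-t))) := by
    have hgeo : Summable fun k : ℕ => 2 * ‖z‖ ^ k :=
      (summable_geometric_of_lt_one (norm_nonneg _) hz).mul_left 2
    refine intervalIntegral.hasSum_integral_of_dominated_convergence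
      (fun k t => |F t| * (2 * ‖z‖ ^ k)) ?_ ?_ ?_ ?_ ?_
    · intro k
      refine (intervalIntegrable_iff.1 (hF.ofReal_mul_continuous ?_)).aestronglyMeasurable
      exact continuous_const.mul
        ((continuous_const.mul (continuous_circlePoint.comp continuous_neg)).pow k)
    · intro k
      refine ae_of_all _ fun t _ => ?_
      rw [norm_mul, norm_mul, norm_pow, hn, Complex.norm_real, Real.norm_eq_abs]
      gcongr
      split_ifs <;> simp
    · exact ae_of_all _ fun t _ => hgeo.mul_left _
    · simp_rw [tsum_mul_left]
      exact hF.abs.mul_const _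
    · exact ae_of_all _ fun t _ => (hasSum_herglotz (by rwa [hn])).mul_left _
  rw [innerOfIntegrable, ← hsum.tsum_eq, ← tsum_mul_left]
  refine tsum_congr fun k => ?_
  rw [taylorCoeff_eq_integral hF, mul_assoc]
  congr 1
  rw [mul_comm, ← intervalIntegral.integral_const_mul]
  refine intervalIntegral.integral_congr fun t _ => ?_
  simp only [mul_pow]
  ring

theorem continuous_herglotz_comp (n : ℕ) {z : ℂ} (hz : ‖z‖ < 1) :
    Continuous fun t => herglotz n (z * circlePoint (-t)) := by
  refine (analyticOnNhd_herglotz n).continuousOn.comp_continuous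
    (continuous_const.mul (continuous_circlePoint.comp continuous_neg)) fun t => ?_
  refine ne_one_of_mem_ball (mem_ball_zero_iff.2 ?_)
  rwa [norm_mul, norm_circlePoint, mul_one]

theorem hasDerivAt_integral_herglotz {F : ℝ → ℝ} {a b : ℝ}
    (hF : IntervalIntegrable F volume a b) (n : ℕ) {z : ℂ} (hz : ‖z‖ < 1) :
    HasDerivAt (fun z => ∫ t in a..b, (F t : ℂ) * herglotz n (z * circlePoint (-t)))
      (∫ t in a..b, (F t : ℂ) * (deriv (herglotz n) (z * circlePoint (-t)) * circlePoint (-t)))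
      z := by
  -- A radius strictly below `1` keeps all rotated points away from the pole at `1`, so the
  -- derivative of the kernel is bounded uniformly in `t`.
  obtain ⟨ρ, hzρ, hρ⟩ := exists_between hz
  have hmem : ∀ x ∈ Metric.ball (0 : ℂ) ρ, ∀ t, x * circlePoint (-t) ∈ Metric.closedBall (0 : ℂ) ρ := by
    intro x hx t
    rw [mem_closedBall_zero_iff, norm_mul, norm_circlePoint, mul_one]
    exact (mem_ball_zero_iff.1 hx).le
  have hsub : Metric.closedBall (0 : ℂ) ρ ⊆ {1}ᶜ := fun x hx =>
    ne_one_of_mem_ball (Metric.closedBall_subset_ball hρ hx)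
  have hdc := ((analyticOnNhd_herglotz n).deriv.continuousOn).mono hsub
  obtain ⟨M, hM⟩ := (isCompact_closedBall (0 : ℂ) ρ).exists_bound_of_continuousOn hdc
  have hcont : Continuous fun t => circlePoint (-t) := continuous_circlePoint.comp continuous_neg
  refine (intervalIntegral.hasDerivAt_integral_of_dominated_loc_of_deriv_le
    (bound := fun t => |F t| * M) (s := Metric.ball 0 ρ)
    (F' := fun z t => (F t : ℂ) * (deriv (herglotz n) (z * circlePoint (-t)) * circlePoint (-t)))
    (Metric.isOpen_ball.mem_nhds (mem_ball_zero_iff.2 hzρ)) ?_ ?_ ?_ ?_ ?_ ?_).2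
  · filter_upwards [Metric.isOpen_ball.mem_nhds (mem_ball_zero_iff.2 hz)] with x hx
    exact (intervalIntegrable_iff.1 (hF.ofReal_mul_continuous
      (continuous_herglotz_comp n (mem_ball_zero_iff.1 hx)))).aestronglyMeasurable
  · exact hF.ofReal_mul_continuous (continuous_herglotz_comp n hz)
  · refine (intervalIntegrable_iff.1 (hF.ofReal_mul_continuous ?_)).aestronglyMeasurable
    refine Continuous.mul ?_ hcont
    exact hdc.comp_continuous (continuous_const.mul hcont)
      fun t => hmem z (mem_ball_zero_iff.2 hzρ) t
  · refine ae_of_all _ fun t _ x hx => ?_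
    rw [norm_mul, norm_mul, norm_circlePoint, mul_one, Complex.norm_real, Real.norm_eq_abs]
    exact mul_le_mul_of_nonneg_left (hM _ (hmem x hx t)) (abs_nonneg _)
  · exact hF.abs.mul_const _
  · refine ae_of_all _ fun t _ x hx => ?_
    have h1 := (analyticOnNhd_herglotz n _ (hsub (hmem x hx t))).differentiableAt.hasDerivAt
    have h2 := (hasDerivAt_id x).mul_const (circlePoint (-t))
    refine ((HasDerivAt.comp x h1 h2).const_mul (F t : ℂ)).congr_deriv ?_
    simp

/-- The angular derivative commutes with rotations of `z`, so each one passes under the integral and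
falls on the kernel alone. -/
theorem iterate_angularDeriv_innerOfIntegrable {F : ℝ → ℝ}
    (hF : IntervalIntegrable F volume (-Real.pi) Real.pi) (n : ℕ) {z : ℂ} (hz : ‖z‖ < 1) :
    angularDeriv^[n] (innerOfIntegrable F) z = (1 / (2 * Real.pi) : ℝ) *
      ∫ t in (-Real.pi)..Real.pi, (F t : ℂ) * herglotz n (z * circlePoint (-t)) := by
  induction n generalizing z with
  | zero => exact innerOfIntegrable_eq_integral hF hz
  | succ n ih =>
    have hev : angularDeriv^[n] (innerOfIntegrable F) =ᶠ[𝓝 z] fun z => (1 / (2 * Real.pi) : ℝ) *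
        ∫ t in (-Real.pi)..Real.pi, (F t : ℂ) * herglotz n (z * circlePoint (-t)) := by
      filter_upwards [Metric.isOpen_ball.mem_nhds (mem_ball_zero_iff.2 hz)] with x hx
      exact ih (mem_ball_zero_iff.1 hx)
    rw [Function.iterate_succ_apply', angularDeriv, hev.deriv_eq,
      ((hasDerivAt_integral_herglotz hF n hz).const_mul _).deriv, mul_left_comm,
      ← intervalIntegral.integral_const_mul]
    congr 1
    refine intervalIntegral.integral_congr fun t _ => ?_
    simp only [herglotz_succ]
    ring

theorem differentiableOn_iterate_angularDeriv {F : ℝ → ℝ}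
    (hF : IntervalIntegrable F volume (-Real.pi) Real.pi) (n : ℕ) :
    DifferentiableOn ℂ (angularDeriv^[n] (innerOfIntegrable F)) (Metric.ball 0 1) := by
  intro z hz
  refine DifferentiableWithinAt.congr (f := fun z => (1 / (2 * Real.pi) : ℝ) *
    ∫ t in (-Real.pi)..Real.pi, (F t : ℂ) * herglotz n (z * circlePoint (-t))) ?_
    (fun x hx => iterate_angularDeriv_innerOfIntegrable hF n (mem_ball_zero_iff.1 hx))
    (iterate_angularDeriv_innerOfIntegrable hF n (mem_ball_zero_iff.1 hz))
  exact ((hasDerivAt_integral_herglotz hF n (mem_ball_zero_iff.1 hz)).const_mul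
    _).differentiableAt.differentiableWithinAt

theorem iterate_angularDeriv_re {F : ℝ → ℝ}
    (hF : IntervalIntegrable F volume (-Real.pi) Real.pi)
    (hper : Function.Periodic F (2 * Real.pi)) (n : ℕ) (θ : ℝ) {r : ℝ} (hr : |r| < 1) :
    (angularDeriv^[n] (innerOfIntegrable F) (r * circlePoint θ)).re = 1 / (2 * Real.pi) *
      ∫ s in (-Real.pi)..Real.pi, F (θ + s) * reKernel n r s := by
  have hz : ‖(r : ℂ) * circlePoint θ‖ < 1 := by simpa [norm_circlePoint] using hr
  have hk : ∀ t, (herglotz n (r * circlePoint θ * circlePoint (-t))).re =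
      reKernel n r (t - θ) := by
    intro t
    rw [reKernel, mul_assoc, ← circlePoint_add]
    congr 4
    ring
  have h1 : (∫ t in (-Real.pi)..Real.pi,
      (F t : ℂ) * herglotz n (r * circlePoint θ * circlePoint (-t))).re =
      ∫ t in (-Real.pi)..Real.pi, F t * reKernel n r (t - θ) := by
    have := Complex.reCLM.intervalIntegral_comp_comm
      (hF.ofReal_mul_continuous (continuous_herglotz_comp n hz))
    rw [Complex.reCLM_apply] at this
    rw [← this]
    refine intervalIntegral.integral_congr fun t _ => ?_
    simp only [Complex.reCLM_apply, Complex.re_ofReal_mul, hk]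
  rw [iterate_angularDeriv_innerOfIntegrable hF n hz, Complex.re_ofReal_mul, h1]
  congr 1
  -- Periodicity moves the translated window back to `[-π, π]`, with the singularity of the kernel
  -- at its centre.
  have hp : Function.Periodic (fun s => F (θ + s) * reKernel n r s) (2 * Real.pi) := fun s => by
    simp only [← add_assoc, hper (θ + s), reKernel_periodic n r s]
  have h2 := intervalIntegral.integral_comp_sub_right (a := -Real.pi) (b := Real.pi)
    (fun s => F (θ + s) * reKernel n r s) θ
  simp only [add_sub_cancel] at h2
  rw [h2]
  have h3 := hp.intervalIntegral_add_eq (-Real.pi - θ) (-Real.pi)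
  convert h3 using 2 <;> ring

/-! ### Radial limits of the real part -/

/-- Integration by parts for indefinite integrals of integrable functions. -/
theorem integral_mul_add_mul_of_primitive {f f' g g' : ℝ → ℝ} {a b : ℝ} (hab : a ≤ b)
    (hf' : IntervalIntegrable f' volume a b) (hg' : IntervalIntegrable g' volume a b)
    (hf : ∀ x ∈ Icc a b, f x - f a = ∫ t in a..x, f' t)
    (hg : ∀ x ∈ Icc a b, g x - g a = ∫ t in a..x, g' t) :
    ∫ x in a..b, (f' x * g x + f x * g' x) = f b * g b - f a * g a := by
  -- Outside `[a, b]` nothing is known of `f` and `g`; they are replaced by indefinite integrals,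
  -- which are absolutely continuous.
  set p : ℝ → ℝ := fun x => f a + ∫ t in a..x, f' t with hp
  set q : ℝ → ℝ := fun x => g a + ∫ t in a..x, g' t with hq
  have hfp : ∀ x ∈ Icc a b, f x = p x := fun x hx => by rw [hp]; linarith [hf x hx]
  have hgq : ∀ x ∈ Icc a b, g x = q x := fun x hx => by rw [hq]; linarith [hg x hx]
  have hac : ∀ (c : ℝ) {h : ℝ → ℝ}, IntervalIntegrable h volume a b →
      AbsolutelyContinuousOnInterval (fun x => c + ∫ t in a..x, h t) a b := by
    intro c h hh
    have h1 := hh.absolutelyContinuousOnInterval_intervalIntegral (c := a) left_mem_uIcc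
    have h2 : AbsolutelyContinuousOnInterval (fun _ : ℝ => c) a b :=
      (LipschitzWith.const c).lipschitzOnWith.absolutelyContinuousOnInterval
    exact h2.add h1
  have hd : ∀ (c : ℝ) {h : ℝ → ℝ}, IntervalIntegrable h volume a b →
      ∀ᵐ x, x ∈ uIcc a b → deriv (fun x => c + ∫ t in a..x, h t) x = h x := by
    intro c h hh
    filter_upwards [hh.ae_hasDerivAt_integral] with x hx hx2
    exact ((hx hx2 a left_mem_uIcc).const_add c).deriv
  have key := (hac (f a) hf').integral_deriv_mul_eq_sub (hac (g a) hg')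
  have ha := left_mem_Icc.2 hab
  have hb := right_mem_Icc.2 hab
  rw [hfp b hb, hgq b hb, hfp a ha, hgq a ha, ← key]
  refine intervalIntegral.integral_congr_ae ?_
  filter_upwards [hd (f a) hf', hd (g a) hg'] with x h1 h2 hx
  have hx' := uIoc_subset_uIcc hx
  rw [h1 hx', h2 hx']
  rw [uIcc_of_le hab] at hx'
  rw [hfp x hx', hgq x hx']

theorem reKernel_sub_eq_integral (n : ℕ) {r : ℝ} (hr : |r| < 1) (a x : ℝ) :
    reKernel n r x - reKernel n r a = ∫ t in a..x, -reKernel (n + 1) r t :=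
  (intervalIntegral.integral_eq_sub_of_hasDerivAt (fun t _ => hasDerivAt_reKernel n hr t)
    ((continuous_reKernel (n + 1) hr).neg.intervalIntegrable _ _)).symm

/-- Integration by parts trades one primitive of the function for one angular derivative of the
kernel. The boundary terms are values of the kernel at the endpoints, which vanish as `r → 1` when
these lie in `[-π, π]` and differ from `0`. -/
theorem integral_primitive_mul_reKernel {f f' : ℝ → ℝ} {a b : ℝ} (hab : a ≤ b)
    (hf' : IntervalIntegrable f' volume a b)
    (hf : ∀ x ∈ Icc a b, f x - f a = ∫ t in a..x, f' t) (n : ℕ) {r : ℝ} (hr : |r| < 1) :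
    ∫ x in a..b, f x * reKernel (n + 1) r x =
      (∫ x in a..b, f' x * reKernel n r x) - (f b * reKernel n r b - f a * reKernel n r a) := by
  have hk := continuous_reKernel n hr
  have hk1 := continuous_reKernel (n + 1) hr
  have hfc : ContinuousOn f (uIcc a b) := by
    have h1 := (hf'.absolutelyContinuousOnInterval_intervalIntegral
      (c := a) left_mem_uIcc).continuousOn
    refine ((continuousOn_const (c := f a)).add h1).congr fun x hx => ?_
    rw [uIcc_of_le hab] at hx
    rw [Pi.add_apply]
    linarith [hf x hx]
  have h := integral_mul_add_mul_of_primitive hab hf' (hk1.neg.intervalIntegrable a b) hf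
    (fun x _ => reKernel_sub_eq_integral n hr a x)
  rw [intervalIntegral.integral_add (hf'.mul_continuousOn hk.continuousOn)
    ((hk1.neg.intervalIntegrable a b).continuousOn_mul hfc)] at h
  simp only [Pi.neg_apply, mul_neg, intervalIntegral.integral_neg] at h
  linarith

theorem eventually_abs_lt_one : ∀ᶠ r : ℝ in 𝓝[<] 1, |r| < 1 := by
  filter_upwards [Ioo_mem_nhdsLT (zero_lt_one (α := ℝ))] with r hr
  rw [abs_of_pos hr.1]
  exact hr.2

/-- The part of the singular integral away from the singularity of the kernel is negligible. -/
theorem tendsto_integral_mul_reKernel_zero {h : ℝ → ℝ} {a b δ : ℝ} (hδ : 0 < δ)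
    (hh : IntervalIntegrable h volume a b)
    (hsub : ∀ s ∈ uIcc a b, δ ≤ |s| ∧ |s| ≤ Real.pi) (n : ℕ) :
    Tendsto (fun r => ∫ s in a..b, h s * reKernel n r s) (𝓝[<] 1) (𝓝 0) := by
  have hu := tendstoUniformlyOn_reKernel n hδ
  have h0 : ∫ s in a..b, h s * 0 = 0 := by simp
  rw [← h0]
  refine intervalIntegral.tendsto_integral_filter_of_dominated_convergence (fun s => |h s|)
    ?_ ?_ hh.abs ?_
  · filter_upwards [eventually_abs_lt_one] with r hr
    exact (intervalIntegrable_iff.1 (hh.mul_continuousOn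
      (continuous_reKernel n hr).continuousOn)).aestronglyMeasurable
  · filter_upwards [Metric.tendstoUniformlyOn_iff.1 hu 1 one_pos] with r hr
    refine ae_of_all _ fun s hs => ?_
    have := hr s (hsub s (uIoc_subset_uIcc hs))
    rw [Pi.zero_apply, dist_comm, dist_zero_right, Real.norm_eq_abs] at this
    rw [norm_mul, Real.norm_eq_abs, Real.norm_eq_abs]
    exact mul_le_of_le_one_right (abs_nonneg _) this.le
  · exact ae_of_all _ fun s hs =>
      (hu.tendsto_at (hsub s (uIoc_subset_uIcc hs))).const_mul _

/-- This is the mean value property on the circle of radius `r`, with value `1` of the Herglotz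
kernel at the centre. -/
theorem integral_reKernel_zero {r : ℝ} (h0 : 0 ≤ r) (h1 : r < 1) :
    ∫ s in (-Real.pi)..Real.pi, reKernel 0 r s = 2 * Real.pi := by
  have hd : ∀ z ∈ Metric.closedBall (0 : ℂ) |r|, DifferentiableAt ℂ (herglotz 0) z := fun z hz =>
    (analyticOnNhd_herglotz 0 z (ne_one_of_mem_ball (Metric.closedBall_subset_ball
      (by rwa [abs_of_nonneg h0]) hz))).differentiableAt
  have havg : Real.circleAverage (herglotz 0) 0 r = herglotz 0 0 :=
    circleAverage_of_differentiable_on_off_countable countable_empty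
      (fun z hz => (hd z hz).continuousAt.continuousWithinAt)
      (fun z hz => hd z (Metric.ball_subset_closedBall hz.1))
  have hv : herglotz 0 0 = 1 := by simp [herglotz]
  have hr : |r| < 1 := by rwa [abs_of_nonneg h0]
  rw [hv, Real.circleAverage_def] at havg
  have hint : IntervalIntegrable (fun θ => herglotz 0 (circleMap 0 r θ)) volume 0
      (2 * Real.pi) := by
    refine Continuous.intervalIntegrable ?_ _ _
    refine (analyticOnNhd_herglotz 0).continuousOn.comp_continuous (continuous_circleMap 0 r)
      fun t => ne_one_of_mem_ball ?_
    simpa using hr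
  have hre := Complex.reCLM.intervalIntegral_comp_comm hint
  have h2 : ∀ θ, (herglotz 0 (circleMap 0 r θ)).re = reKernel 0 r θ := by
    intro θ
    rw [← reKernel_neg_zero, reKernel, neg_neg, circleMap_zero]
    rfl
  simp only [Complex.reCLM_apply, h2] at hre
  have h3 := congrArg Complex.re havg
  rw [Complex.real_smul, Complex.re_ofReal_mul, ← hre, Complex.one_re] at h3
  have hp := (reKernel_periodic 0 r).intervalIntegral_add_eq (-Real.pi) 0
  have e1 : -Real.pi + 2 * Real.pi = Real.pi := by ring
  rw [e1, zero_add] at hp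
  rw [hp]
  have := Real.pi_pos
  field_simp at h3
  exact h3

variable {δ : ℝ}

theorem mem_uIcc_right_bounds (h0 : 0 < δ) (h1 : δ ≤ Real.pi) :
    ∀ s ∈ uIcc δ Real.pi, δ ≤ |s| ∧ |s| ≤ Real.pi := by
  intro s hs
  rw [uIcc_of_le h1] at hs
  rw [abs_of_pos (h0.trans_le hs.1)]
  exact hs

theorem mem_uIcc_left_bounds (h0 : 0 < δ) (h1 : δ ≤ Real.pi) :
    ∀ s ∈ uIcc (-Real.pi) (-δ), δ ≤ |s| ∧ |s| ≤ Real.pi := by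
  intro s hs
  rw [uIcc_of_le (neg_le_neg h1)] at hs
  rw [abs_of_neg (by linarith [hs.2])]
  exact ⟨by linarith [hs.2], by linarith [hs.1]⟩

/-- Only the part of the integral near the singularity of the kernel matters. -/
theorem tendsto_integral_reKernel_of_local {h : ℝ → ℝ} (h0 : 0 < δ) (h1 : δ ≤ Real.pi)
    (hh : IntervalIntegrable h volume (-Real.pi) Real.pi) (n : ℕ) (A : ℝ) :
    Tendsto (fun r => ∫ s in (-Real.pi)..Real.pi, h s * reKernel n r s) (𝓝[<] 1) (𝓝 A) ↔
      Tendsto (fun r => ∫ s in (-δ)..δ, h s * reKernel n r s) (𝓝[<] 1) (𝓝 A) := by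
  have hpi := Real.pi_pos
  have i1 : IntervalIntegrable h volume (-Real.pi) (-δ) := hh.mono_set (by
    rw [uIcc_of_le (by linarith), uIcc_of_le (by linarith)]; exact Icc_subset_Icc le_rfl (by linarith))
  have i2 : IntervalIntegrable h volume (-δ) δ := hh.mono_set (by
    rw [uIcc_of_le (by linarith), uIcc_of_le (by linarith)]
    exact Icc_subset_Icc (by linarith) (by linarith))
  have i3 : IntervalIntegrable h volume δ Real.pi := hh.mono_set (by
    rw [uIcc_of_le (by linarith), uIcc_of_le (by linarith)]; exact Icc_subset_Icc (by linarith) le_rfl)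
  have t1 := tendsto_integral_mul_reKernel_zero h0 i1 (mem_uIcc_left_bounds h0 h1) n
  have t3 := tendsto_integral_mul_reKernel_zero h0 i3 (mem_uIcc_right_bounds h0 h1) n
  have hev : ∀ᶠ r in 𝓝[<] (1 : ℝ), ∫ s in (-Real.pi)..Real.pi, h s * reKernel n r s =
      (∫ s in (-δ)..δ, h s * reKernel n r s) +
      ((∫ s in (-Real.pi)..(-δ), h s * reKernel n r s) +
        ∫ s in δ..Real.pi, h s * reKernel n r s) := by
    filter_upwards [eventually_abs_lt_one] with r hr
    have hk := (continuous_reKernel n hr)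
    have j1 := i1.mul_continuousOn hk.continuousOn
    have j2 := i2.mul_continuousOn hk.continuousOn
    have j3 := i3.mul_continuousOn hk.continuousOn
    rw [← intervalIntegral.integral_add_adjacent_intervals j1 (j2.trans j3),
      ← intervalIntegral.integral_add_adjacent_intervals j2 j3]
    ring
  have t13 := t1.add t3
  rw [add_zero] at t13
  rw [tendsto_congr' hev]
  constructor
  · intro h
    simpa using h.sub t13
  · intro h
    simpa using h.add t13

/-- The total mass of the peak kernel: integrating by parts with the function `s` reduces it to the
mass of the Poisson kernel. -/
theorem tendsto_integral_mul_self_reKernel_one (h0 : 0 < δ) (h1 : δ ≤ Real.pi) :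
    Tendsto (fun r => ∫ s in (-δ)..δ, s * reKernel 1 r s) (𝓝[<] 1) (𝓝 (2 * Real.pi)) := by
  have hP : Tendsto (fun r => ∫ s in (-δ)..δ, 1 * reKernel 0 r s) (𝓝[<] 1) (𝓝 (2 * Real.pi)) := by
    rw [← tendsto_integral_reKernel_of_local h0 h1 (by simp)]
    refine tendsto_const_nhds.congr' ?_
    filter_upwards [Ioo_mem_nhdsLT (zero_lt_one (α := ℝ))] with r hr
    simp only [one_mul]
    exact (integral_reKernel_zero hr.1.le hr.2).symm
  have hb := tendsto_reKernel 0 h0.ne' (by rwa [abs_of_pos h0])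
  have ha := tendsto_reKernel 0 (neg_ne_zero.2 h0.ne') (by rwa [abs_neg, abs_of_pos h0])
  have hlim := hP.sub ((hb.const_mul δ).sub (ha.const_mul (-δ)))
  simp only [mul_zero, sub_zero] at hlim
  refine hlim.congr' ?_
  filter_upwards [eventually_abs_lt_one] with r hr
  refine (integral_primitive_mul_reKernel (f := fun s => s) (f' := fun _ => 1) (by linarith)
    (by simp) (fun x _ => ?_) 0 hr).symm
  simp

/-- Fatou's theorem at a point where the indefinite integral is differentiable. -/
theorem tendsto_integral_mul_reKernel_one {H : ℝ → ℝ} {A : ℝ} (h0 : 0 < δ) (h1 : δ ≤ Real.pi)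
    (hc : ContinuousOn H (Icc (-δ) δ)) (hH : H 0 = 0) (hd : HasDerivAt H A 0) :
    Tendsto (fun r => ∫ s in (-δ)..δ, H s * reKernel 1 r s) (𝓝[<] 1) (𝓝 (2 * Real.pi * A)) := by
  have hpi := Real.pi_pos
  have hle : -δ ≤ δ := by linarith
  have hnhds : Icc (-δ) δ ∈ 𝓝 (0 : ℝ) := Icc_mem_nhds (by linarith) h0
  have hds : ContinuousOn (dslope H 0) (Icc (-δ) δ) :=
    (continuousOn_dslope hnhds).2 ⟨hc, hd.differentiableAt⟩
  have hbd : ∀ s ∈ Icc (-δ) δ, |s| ≤ Real.pi := fun s hs => (abs_le.2 hs).trans h1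
  -- As `H 0 = 0`, `H s` is `s` times `dslope H 0 s`, which is continuous with value `A` at `0`. The
  -- factor `s` goes to the kernel, making it nonnegative.
  have key := tendsto_setIntegral_peak_smul_of_integrableOn_of_tendsto (μ := volume)
    (s := Icc (-δ) δ) (t := Icc (-δ) δ) (x₀ := (0 : ℝ)) (l := 𝓝[<] (1 : ℝ))
    (φ := fun r s => (2 * Real.pi)⁻¹ * (s * reKernel 1 r s)) (g := dslope H 0) (a := A)
    measurableSet_Icc measurableSet_Icc subset_rfl self_mem_nhdsWithin
    (by simp) ?_ ?_ ?_ ?_ hds.integrableOn_Icc ?_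
  · have h2 := key.const_mul (2 * Real.pi)
    refine h2.congr fun r => ?_
    rw [intervalIntegral.integral_of_le hle, ← integral_Icc_eq_integral_Ioc,
      ← integral_const_mul]
    refine setIntegral_congr_fun measurableSet_Icc fun s _ => ?_
    have h3 := sub_smul_dslope H 0 s
    rw [sub_zero, hH, sub_zero, smul_eq_mul] at h3
    simp only [smul_eq_mul]
    rw [← h3]
    field_simp
  · filter_upwards [Ioo_mem_nhdsLT (zero_lt_one (α := ℝ))] with r hr s hs
    exact mul_nonneg (by positivity) (mul_reKernel_one_nonneg hr.1.le hr.2 (hbd s hs))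
  · intro u hu h0u
    obtain ⟨ε, hε, hball⟩ := Metric.isOpen_iff.1 hu 0 h0u
    have hun := (tendstoUniformlyOn_reKernel 1 hε).mono (s' := Icc (-δ) δ \ u) (by
      intro s hs
      refine ⟨not_lt.1 fun h => hs.2 (hball ?_), hbd s hs.1⟩
      simpa using h)
    rw [Metric.tendstoUniformlyOn_iff] at hun ⊢
    intro η hη
    filter_upwards [hun η hη] with r hr s hs
    have h3 := hr s hs
    simp only [Pi.zero_apply, dist_zero_left, Real.norm_eq_abs] at h3 ⊢
    rw [abs_mul, abs_mul, ← mul_assoc, abs_inv, abs_of_pos (by positivity : 0 < 2 * Real.pi)]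
    refine lt_of_le_of_lt (mul_le_of_le_one_left (abs_nonneg _) ?_) h3
    rw [inv_mul_le_one₀ (by positivity)]
    linarith [hbd s hs.1]
  · have h2 := (tendsto_integral_mul_self_reKernel_one h0 h1).const_mul (2 * Real.pi)⁻¹
    rw [inv_mul_cancel₀ (by positivity)] at h2
    refine h2.congr fun r => ?_
    rw [intervalIntegral.integral_of_le hle, ← integral_Icc_eq_integral_Ioc,
      ← integral_const_mul]
  · filter_upwards [eventually_abs_lt_one] with r hr
    have := continuous_reKernel 1 hr
    exact Continuous.aestronglyMeasurable (by fun_prop)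
  · have h2 := (hds 0 (mem_of_mem_nhds hnhds))
    rwa [ContinuousWithinAt, dslope_same, hd.deriv] at h2

/-- The `m`-th derivative of the Poisson integral of an `m`-th primitive of `h 0` converges
to `h 0` at a point where the indefinite integral of `h 0` is differentiable. -/
theorem tendsto_integral_primitive_mul_reKernel {h : ℕ → ℝ → ℝ} {A : ℝ} (h0 : 0 < δ)
    (h1 : δ ≤ Real.pi) (m : ℕ)
    (hint : ∀ k ≤ m, IntervalIntegrable (h k) volume (-δ) δ)
    (hprim : ∀ k < m, ∀ x ∈ Icc (-δ) δ, h (k + 1) x - h (k + 1) (-δ) = ∫ t in (-δ)..x, h k t)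
    (hd : HasDerivAt (fun x => ∫ t in (0 : ℝ)..x, h 0 t) A 0) :
    Tendsto (fun r => ∫ s in (-δ)..δ, h m s * reKernel m r s) (𝓝[<] 1) (𝓝 (2 * Real.pi * A)) := by
  have hle : -δ ≤ δ := by linarith
  have hbdry : ∀ (f : ℝ → ℝ) (n : ℕ), Tendsto
      (fun r => f δ * reKernel n r δ - f (-δ) * reKernel n r (-δ)) (𝓝[<] 1) (𝓝 0) := by
    intro f n
    have hb := tendsto_reKernel n h0.ne' (by rwa [abs_of_pos h0])
    have ha := tendsto_reKernel n (neg_ne_zero.2 h0.ne') (by rwa [abs_neg, abs_of_pos h0])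
    simpa using (hb.const_mul (f δ)).sub (ha.const_mul (f (-δ)))
  induction m with
  | zero =>
    have hi := hint 0 le_rfl
    have hmem : (0 : ℝ) ∈ uIcc (-δ) δ := by
      rw [uIcc_of_le hle]
      exact ⟨by linarith, h0.le⟩
    have hH : ContinuousOn (fun x => ∫ t in (0 : ℝ)..x, h 0 t) (Icc (-δ) δ) := by
      have := (hi.absolutelyContinuousOnInterval_intervalIntegral hmem).continuousOn
      rwa [uIcc_of_le hle] at this
    -- The Poisson integral of `h 0` is handled through its indefinite integral: only
    -- differentiability of the latter at `0` is assumed.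
    have key := tendsto_integral_mul_reKernel_one h0 h1 hH intervalIntegral.integral_same hd
    have hsum := key.add (hbdry (fun x => ∫ t in (0 : ℝ)..x, h 0 t) 0)
    rw [add_zero] at hsum
    refine hsum.congr' ?_
    filter_upwards [eventually_abs_lt_one] with r hr
    rw [integral_primitive_mul_reKernel (f' := h 0) hle hi ?_ 0 hr]
    · ring
    · intro x hx
      have hx' : x ∈ uIcc (-δ) δ := by rwa [uIcc_of_le hle]
      exact intervalIntegral.integral_interval_sub_left
        (hi.mono_set (uIcc_subset_uIcc hmem hx')) (hi.mono_set (uIcc_subset_uIcc hmem left_mem_uIcc))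
  | succ m ih =>
    have key := ih (fun k hk => hint k (hk.trans m.le_succ))
      (fun k hk => hprim k (hk.trans m.lt_succ_self))
    have hsub := key.sub (hbdry (h (m + 1)) m)
    rw [sub_zero] at hsub
    refine hsub.congr' ?_
    filter_upwards [eventually_abs_lt_one] with r hr
    exact (integral_primitive_mul_reKernel hle (hint m m.le_succ) (hprim m m.lt_succ_self) m hr).symm

/-! ### The singular set, and differentiability of the indefinite integral off it -/

theorem isClosed_nonIntegrableSet (g : ℝ → ℝ) : IsClosed (nonIntegrableSet g) := by
  rw [← isOpen_compl_iff, isOpen_iff_mem_nhds]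
  intro x hx
  simp only [nonIntegrableSet, mem_compl_iff, mem_ofPred_eq, not_not] at hx
  obtain ⟨s, hs, hi⟩ := hx
  filter_upwards [eventually_mem_nhds_iff.2 hs] with y hy
  simp only [nonIntegrableSet, mem_compl_iff, mem_ofPred_eq, not_not]
  exact ⟨s, hy, hi⟩

theorem integrableAtFilter_add_right {g : ℝ → ℝ} {T : ℝ} (hg : Function.Periodic g T) {x : ℝ}
    (h : IntegrableAtFilter g (𝓝 x) volume) : IntegrableAtFilter g (𝓝 (x + T)) volume := by
  obtain ⟨s, hs, hi⟩ := h
  refine ⟨(fun y => y - T) ⁻¹' s, ?_, ?_⟩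
  · have hc : ContinuousAt (fun y : ℝ => y - T) (x + T) := by fun_prop
    exact hc.preimage_mem_nhds (by simpa using hs)
  · have hmp := measurePreserving_sub_right (volume : Measure ℝ) T
    have := (hmp.integrableOn_comp_preimage (MeasurableEquiv.subRight T).measurableEmbedding
      (f := g) (s := s)).2 hi
    refine this.congr_fun_ae (ae_of_all _ fun y => ?_)
    exact hg.sub_eq y

theorem countable_nonIntegrableSet {g : ℝ → ℝ} {T : ℝ} (hT : 0 < T) (hg : Function.Periodic g T)
    (hfin : (nonIntegrableSet g ∩ Ico 0 T).Finite) : (nonIntegrableSet g).Countable := by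
  have hsub : nonIntegrableSet g ⊆
      ⋃ n : ℤ, (fun y => y + n • T) '' (nonIntegrableSet g ∩ Ico 0 T) := by
    intro x hx
    refine mem_iUnion.2 ⟨toIcoDiv hT 0 x, x - toIcoDiv hT 0 x • T, ⟨fun h => hx ?_, ?_⟩, by simp⟩
    · simpa using integrableAtFilter_add_right (hg.zsmul (toIcoDiv hT 0 x)) h
    · simpa using sub_toIcoDiv_zsmul_mem_Ico hT 0 x
  exact (countable_iUnion fun n => hfin.countable.image _).mono hsub

theorem exists_rat_Icc_disjoint {S : Set ℝ} (hS : IsClosed S) {x : ℝ} (hx : x ∉ S) :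
    ∃ p q : ℚ, x ∈ Ioo (p : ℝ) q ∧ Disjoint (Icc (p : ℝ) q) S := by
  obtain ⟨ε, hε, hball⟩ := Metric.isOpen_iff.1 hS.isOpen_compl x hx
  obtain ⟨p, hp1, hp2⟩ := exists_rat_btwn (show x - ε < x by linarith)
  obtain ⟨q, hq1, hq2⟩ := exists_rat_btwn (show x < x + ε by linarith)
  refine ⟨p, q, ⟨hp2, hq1⟩, Set.disjoint_left.2 fun y hy => hball ?_⟩
  rw [Metric.mem_ball, Real.dist_eq, abs_lt]
  exact ⟨by linarith [hy.1], by linarith [hy.2]⟩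

/-- At almost every point off the singular set the indefinite integral is differentiable. -/
theorem ae_hasDerivAt_integral_of_notMem {g : ℝ → ℝ} {T : ℝ} (hg : LocallyIntegrableAE g T) :
    ∀ᵐ x, x ∉ nonIntegrableSet g → HasDerivAt (fun y => ∫ t in x..y, g t) (g x) x := by
  -- Rational endpoints leave only countably many exceptional null sets.
  have h : ∀ p q : ℚ, ∀ᵐ x, Disjoint (Icc (p : ℝ) q) (nonIntegrableSet g) →
      x ∈ Ioo (p : ℝ) q → HasDerivAt (fun y => ∫ t in x..y, g t) (g x) x := by
    intro p q
    by_cases hd : Disjoint (Icc (p : ℝ) q) (nonIntegrableSet g) ∧ (p : ℝ) ≤ q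
    · have hi : IntervalIntegrable g volume p q :=
        (intervalIntegrable_iff_integrableOn_Icc_of_le hd.2).2 (hg.2 p q hd.1)
      filter_upwards [hi.ae_hasDerivAt_integral] with x hx _ hx2
      have hx3 : x ∈ uIcc (p : ℝ) q := by
        rw [uIcc_of_le hd.2]
        exact Ioo_subset_Icc_self hx2
      exact hx hx3 x hx3
    · refine ae_of_all _ fun x h1 h2 => absurd ⟨h1, (h2.1.trans h2.2).le⟩ hd
  have h' := ae_all_iff.2 fun p => ae_all_iff.2 (h p)
  filter_upwards [h'] with x hx hxS
  obtain ⟨p, q, h1, h2⟩ := exists_rat_Icc_disjoint (isClosed_nonIntegrableSet g) hxS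
  exact hx p q h2 h1

/-- On a small interval about `θ` that misses the singular set, every piecewise primitive is a true
primitive. The independent constants on the other sections only affect the part of the integral away
from `s = 0`, which tends to zero. -/
theorem tendsto_re_of_isCorrespondingInner {g : ℝ → ℝ} {w : ℂ → ℂ}
    (hper : Function.Periodic g (2 * Real.pi)) (hw : IsCorrespondingInner w g) {θ : ℝ}
    (hθ : θ ∉ nonIntegrableSet g) (hd : HasDerivAt (fun y => ∫ t in θ..y, g t) (g θ) θ) :
    Tendsto (fun ρ : ℝ => (w (ρ * circlePoint θ)).re) (𝓝[<] 1) (𝓝 (g θ)) := by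
  obtain ⟨hloc, n, G, rfl, hprim, hint, hEq⟩ := hw
  have hpi := Real.pi_pos
  obtain ⟨ε, hε, hball⟩ := Metric.isOpen_iff.1 (isClosed_nonIntegrableSet (G 0)).isOpen_compl θ hθ
  obtain ⟨δ, h0, hδ⟩ := exists_between (lt_min hε hpi)
  have h1 : δ ≤ Real.pi := (hδ.trans_le (min_le_right _ _)).le
  have hδε : δ < ε := hδ.trans_le (min_le_left _ _)
  have hdisj : ∀ a b, θ - δ ≤ a → b ≤ θ + δ → Disjoint (Icc a b) (nonIntegrableSet (G 0)) := by
    intro a b ha hb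
    refine Set.disjoint_left.2 fun y hy => hball ?_
    rw [Metric.mem_ball, Real.dist_eq, abs_lt]
    exact ⟨by linarith [hy.1], by linarith [hy.2]⟩
  have hGper : Function.Periodic (G n) (2 * Real.pi) := by
    cases n with
    | zero => exact hper
    | succ m => exact (hprim m m.lt_succ_self).1
  have hGint : IntervalIntegrable (fun s => G n (θ + s)) volume (-Real.pi) Real.pi := by
    have h2 : IntervalIntegrable (G n) volume (θ + -Real.pi) (θ + Real.pi) := by
      refine hGper.intervalIntegrable (t := -Real.pi) (by positivity) ?_ _ _
      convert hint using 1
      ring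
    have h3 := h2.comp_add_left θ
    simpa using h3
  have hkint : ∀ k ≤ n, IntervalIntegrable (fun s => G k (θ + s)) volume (-δ) δ := by
    intro k hk
    rcases hk.lt_or_eq with hk | rfl
    · have h2 := ((hprim k hk).2 (θ + -δ) (θ + δ) (by linarith)
        (hdisj _ _ (by linarith) le_rfl)).1.comp_add_left θ
      simpa using h2
    · refine hGint.mono_set ?_
      rw [uIcc_of_le (by linarith), uIcc_of_le (by linarith)]
      exact Icc_subset_Icc (by linarith) h1
  have hkprim : ∀ k < n, ∀ x ∈ Icc (-δ) δ, G (k + 1) (θ + x) - G (k + 1) (θ + -δ) =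
      ∫ t in (-δ)..x, G k (θ + t) := by
    intro k hk x hx
    rw [intervalIntegral.integral_comp_add_left]
    exact ((hprim k hk).2 (θ + -δ) (θ + x) (by linarith [hx.1])
      (hdisj _ _ (by linarith) (by linarith [hx.2]))).2
  have hd0 : HasDerivAt (fun x => ∫ t in (0 : ℝ)..x, G 0 (θ + t)) (G 0 θ) 0 := by
    have e : (fun x => ∫ t in (0 : ℝ)..x, G 0 (θ + t)) =
        fun x => (fun y => ∫ t in θ..y, G 0 t) (θ + x) := by
      funext x
      simp [intervalIntegral.integral_comp_add_left]
    rw [e]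
    exact HasDerivAt.comp_const_add θ 0 (by simpa using hd)
  have key := tendsto_integral_primitive_mul_reKernel (h := fun k s => G k (θ + s)) h0 h1 n hkint
    hkprim hd0
  rw [← tendsto_integral_reKernel_of_local h0 h1 hGint n] at key
  have key2 := key.const_mul (1 / (2 * Real.pi))
  have e : 1 / (2 * Real.pi) * (2 * Real.pi * G 0 θ) = G 0 θ := by field_simp
  rw [e] at key2
  refine key2.congr' ?_
  filter_upwards [eventually_abs_lt_one] with r hr
  rw [hEq (ofReal_mul_circlePoint_mem_ball hr θ), iterate_angularDeriv_re hint hGper n θ hr]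

theorem ae_tendsto_re_of_isCorrespondingInner {g : ℝ → ℝ} {w : ℂ → ℂ}
    (hper : Function.Periodic g (2 * Real.pi)) (hw : IsCorrespondingInner w g) :
    ∀ᵐ θ, Tendsto (fun ρ : ℝ => (w (ρ * circlePoint θ)).re) (𝓝[<] 1) (𝓝 (g θ)) := by
  have hcount := countable_nonIntegrableSet Real.two_pi_pos hper hw.1.1
  have h1 : ∀ᵐ θ, θ ∉ nonIntegrableSet g := measure_eq_zero_iff_ae_notMem.1 (hcount.measure_zero _)
  filter_upwards [h1, ae_hasDerivAt_integral_of_notMem hw.1] with θ h2 h3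
  exact tendsto_re_of_isCorrespondingInner hper hw h2 (h3 h2)

/-! ### Conformal maps -/

/-- The derivative of an injective analytic function does not vanish. -/
theorem deriv_ne_zero_of_injOn {f : ℂ → ℂ} {U : Set ℂ} (hU : IsOpen U)
    (hf : DifferentiableOn ℂ f U) (hinj : InjOn f U) {z₀ : ℂ} (hz : z₀ ∈ U) :
    deriv f z₀ ≠ 0 := by
  intro hd
  have hUn : U ∈ 𝓝 z₀ := hU.mem_nhds hz
  have hfa : AnalyticAt ℂ f z₀ := hf.analyticAt hUn
  have hFa : AnalyticAt ℂ (fun z => f z - f z₀) z₀ := hfa.sub analyticAt_const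
  have hnz : ¬ ∀ᶠ z in 𝓝 z₀, f z - f z₀ = 0 := by
    intro h
    obtain ⟨z, ⟨h1, h2⟩, h3⟩ := (((h.and hUn).filter_mono nhdsWithin_le_nhds).and
      (self_mem_nhdsWithin (a := z₀) (s := {z₀}ᶜ))).exists
    exact h3 (hinj h2 hz (sub_eq_zero.1 h1))
  -- Here `m` is the order of the zero of `f - f z₀`. The vanishing derivative forces `m ≥ 2`, and
  -- `f` is then shown to take a value twice near `z₀`.
  obtain ⟨m, g, hga, hg0, hfg⟩ := hFa.exists_eventuallyEq_pow_smul_nonzero_iff.2 hnz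
  have hm0 : m ≠ 0 := by
    rintro rfl
    have := hfg.self_of_nhds
    simp at this
    exact hg0 this.symm
  have hm1 : m ≠ 1 := by
    rintro rfl
    have h1 : HasDerivAt (fun z => (z - z₀) ^ 1 • g z) (g z₀) z₀ := by
      have := ((hasDerivAt_id z₀).sub_const z₀).mul hga.differentiableAt.hasDerivAt
      simp only [pow_one, smul_eq_mul]
      exact this.congr_deriv (by simp)
    have h2 := (h1.congr_of_eventuallyEq hfg).deriv
    rw [deriv_sub_const, hd] at h2
    exact hg0 h2.symm
  -- An `m`-th root of `g`, analytic at `z₀`: dividing by `g z₀` brings the base near `1`, off the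
  -- branch cut.
  set h : ℂ → ℂ := fun z => g z₀ ^ ((m : ℂ)⁻¹) * (g z / g z₀) ^ ((m : ℂ)⁻¹) with hh
  have hha : AnalyticAt ℂ h z₀ := by
    refine analyticAt_const.mul ((hga.div analyticAt_const hg0).cpow analyticAt_const ?_)
    simp [hg0]
  have hhm : ∀ z, h z ^ m = g z := by
    intro z
    rw [hh, mul_pow, Complex.cpow_nat_inv_pow _ hm0, Complex.cpow_nat_inv_pow _ hm0]
    field_simp
  have hh0 : h z₀ ≠ 0 := fun h0 => hg0 (by rw [← hhm, h0, zero_pow hm0])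
  set φ : ℂ → ℂ := fun z => (z - z₀) * h z with hφ
  have hφa : AnalyticAt ℂ φ z₀ := (analyticAt_id.sub analyticAt_const).mul hha
  have hφd : HasDerivAt φ (h z₀) z₀ := by
    have := ((hasDerivAt_id z₀).sub_const z₀).mul hha.differentiableAt.hasDerivAt
    exact this.congr_deriv (by simp)
  have hφs : HasStrictDerivAt φ (h z₀) z₀ := by
    have := hφa.hasStrictDerivAt
    rwa [hφd.deriv] at this
  have hmap := hφs.map_nhds_eq hh0
  have hφ0 : φ z₀ = 0 := by simp [hφ]
  have hV : U ∩ {z | f z - f z₀ = (z - z₀) ^ m • g z} ∈ 𝓝 z₀ := inter_mem hUn hfg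
  have himg := image_mem_map (m := φ) hV
  rw [hmap, hφ0] at himg
  obtain ⟨ε, hε, hball⟩ := Metric.mem_nhds_iff.1 himg
  -- Near `z₀` one has `f - f z₀ = φ ^ m` with `φ` locally onto. Points where `φ` equals `t` and `ζ
  -- * t` share the value of `f`, and they are distinct when `ζ ≠ 1`.
  set ζ : ℂ := Complex.exp (2 * Real.pi * Complex.I / m) with hζ
  have hprim : IsPrimitiveRoot ζ m := Complex.isPrimitiveRoot_exp m hm0
  set t : ℂ := ((ε / 2 : ℝ) : ℂ) with ht
  have htn : ‖t‖ < ε := by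
    rw [ht, Complex.norm_real, Real.norm_eq_abs, abs_of_pos (by positivity)]
    linarith
  have ht0 : t ≠ 0 := Complex.ofReal_ne_zero.2 (by positivity)
  obtain ⟨z₁, ⟨h1U, h1f⟩, h1⟩ := hball (mem_ball_zero_iff.2 htn)
  obtain ⟨z₂, ⟨h2U, h2f⟩, h2⟩ := hball (show ζ * t ∈ Metric.ball 0 ε by
    rw [mem_ball_zero_iff, norm_mul, hprim.norm'_eq_one hm0, one_mul]
    exact htn)
  have hpow : ∀ z, (z - z₀) ^ m • g z = φ z ^ m := fun z => by
    rw [hφ, mul_pow, hhm, smul_eq_mul]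
  have heq : f z₁ = f z₂ := by
    have e1 : f z₁ - f z₀ = t ^ m := by rw [← h1, ← hpow]; exact h1f
    have e2 : f z₂ - f z₀ = t ^ m := by
      have : f z₂ - f z₀ = (ζ * t) ^ m := by rw [← h2, ← hpow]; exact h2f
      rwa [mul_pow, hprim.pow_eq_one, one_mul] at this
    exact sub_left_injective (e1.trans e2.symm)
  have hz12 := hinj h1U h2U heq
  rw [hz12, h2] at h1
  have hζ1 : ζ = 1 := by
    have : (ζ - 1) * t = 0 := by rw [sub_mul, h1, one_mul, sub_self]
    exact sub_eq_zero.1 ((mul_eq_zero.1 this).resolve_right ht0)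
  exact hprim.ne_one (by omega) hζ1

/-- A nowhere vanishing holomorphic function on a disk has a holomorphic square root. -/
theorem exists_sq_eq_of_ne_zero {f : ℂ → ℂ} {r : ℝ} (hr : 0 < r)
    (hf : DifferentiableOn ℂ f (Metric.ball 0 r)) (h0 : ∀ z ∈ Metric.ball (0 : ℂ) r, f z ≠ 0) :
    ∃ q : ℂ → ℂ, DifferentiableOn ℂ q (Metric.ball 0 r) ∧
      ∀ z ∈ Metric.ball (0 : ℂ) r, q z ^ 2 = f z := by
  have hfd : DifferentiableOn ℂ (deriv f) (Metric.ball 0 r) := hf.deriv Metric.isOpen_ball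
  -- A primitive of `f' / f` with initial value `log (f 0)` is a logarithm of `f`; half of it gives
  -- the square root.
  obtain ⟨p, hp0, hp⟩ := (hfd.div hf h0).isExactOn_ball.with_val_at 0 (Complex.log (f 0))
  have hmem : (0 : ℂ) ∈ Metric.ball (0 : ℂ) r := Metric.mem_ball_self hr
  have hfat : ∀ z ∈ Metric.ball (0 : ℂ) r, HasDerivAt f (deriv f z) z := fun z hz =>
    (hf.differentiableAt (Metric.isOpen_ball.mem_nhds hz)).hasDerivAt
  have hder : ∀ z ∈ Metric.ball (0 : ℂ) r,
      HasDerivAt (fun z => f z * Complex.exp (-p z)) 0 z := by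
    intro z hz
    refine ((hfat z hz).mul ((hp z hz).neg.cexp)).congr_deriv ?_
    have := h0 z hz
    rw [Pi.neg_apply, Pi.div_apply]
    field_simp
    ring
  have hconst : ∀ z ∈ Metric.ball (0 : ℂ) r, f z * Complex.exp (-p z) = 1 := by
    intro z hz
    have := Metric.isOpen_ball.is_const_of_deriv_eq_zero (convex_ball (0 : ℂ) r).isPreconnected
      (fun x hx => (hder x hx).differentiableAt.differentiableWithinAt)
      (fun x hx => (hder x hx).deriv) hz hmem
    rw [this, hp0, Complex.exp_neg, Complex.exp_log (h0 0 hmem), mul_inv_cancel₀ (h0 0 hmem)]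
  refine ⟨fun z => Complex.exp (p z / 2), fun z hz =>
    ((hp z hz).div_const 2).cexp.differentiableAt.differentiableWithinAt, fun z hz => ?_⟩
  have h1 := hconst z hz
  rw [Complex.exp_neg, ← div_eq_mul_inv, div_eq_one_iff_eq (Complex.exp_ne_zero _)] at h1
  rw [h1, ← Complex.exp_nat_mul]
  congr 1
  push_cast
  ring

/-- Transplantation of the real part of a holomorphic function by a conformal map. -/
theorem exists_harmonicOnNhd_comp_eq {γ w : ℂ → ℂ} {U : Set ℂ} (hU : IsOpen U)
    (hγ : DifferentiableOn ℂ γ U) (hinj : InjOn γ U) (hw : DifferentiableOn ℂ w U) :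
    ∃ u : ℂ → ℝ, InnerProductSpace.HarmonicOnNhd u (γ '' U) ∧ ∀ z ∈ U, u (γ z) = (w z).re := by
  have hleft : ∀ z ∈ U, Function.invFunOn γ U (γ z) = z := fun z hz => hinj.leftInvOn_invFunOn hz
  refine ⟨fun p => (w (Function.invFunOn γ U p)).re, ?_, fun z hz => by simp only [hleft z hz]⟩
  rintro _ ⟨z, hz, rfl⟩
  have hUz := hU.mem_nhds hz
  refine AnalyticAt.harmonicAt_re (f := fun p => w (Function.invFunOn γ U p)) ?_
  -- Since the derivative of `γ` is nonzero, analyticity at `γ z` can be tested after composing with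
  -- `γ`, which gives back `w`.
  rw [← analyticAt_comp_iff_of_deriv_ne_zero (hγ.analyticAt hUz)
    (deriv_ne_zero_of_injOn hU hγ hinj hz)]
  refine (hw.analyticAt hUz).congr ?_
  filter_upwards [hUz] with x hx
  rw [Function.comp_apply, hleft x hx]

/-! ### Boundary functions in the Hardy space `H²` -/

/-- Pythagoras for the finite partial sums, then continuity of the norm. -/
theorem _root_.Orthonormal.hasSum_norm_sq {ι E : Type*} [NormedAddCommGroup E]
    [InnerProductSpace ℂ E] {e : ι → E} (he : Orthonormal ℂ e) {a : ι → ℂ} {x : E}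
    (h : HasSum (fun i => a i • e i) x) : HasSum (fun i => ‖a i‖ ^ 2) (‖x‖ ^ 2) := by
  have h1 : Tendsto (fun s : Finset ι => ‖∑ i ∈ s, a i • e i‖ ^ 2) atTop (𝓝 (‖x‖ ^ 2)) :=
    (Tendsto.norm h).pow 2
  refine h1.congr fun s => ?_
  have h2 := he.orthogonalFamily.norm_sum a s
  simpa [LinearIsometry.toSpanSingleton_apply] using h2

/-- Abelian means of a square summable orthonormal series. If the partial norms of the means are
bounded, then the means converge as `r → 1`. -/
theorem _root_.Orthonormal.exists_tendsto_abel {E : Type*} [NormedAddCommGroup E]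
    [InnerProductSpace ℂ E] [CompleteSpace E] {e : ℕ → E} (he : Orthonormal ℂ e) {a : ℕ → ℂ}
    {x : ℝ → E} {M : ℝ}
    (h : ∀ r ∈ Ioo (0 : ℝ) 1, HasSum (fun n => (a n * (r : ℂ) ^ n) • e n) (x r))
    (hM : ∀ᶠ r in 𝓝[<] (1 : ℝ), ‖x r‖ ^ 2 ≤ M) :
    ∃ y : E, Tendsto x (𝓝[<] 1) (𝓝 y) := by
  have hIoo : Ioo (0 : ℝ) 1 ∈ 𝓝[<] (1 : ℝ) := Ioo_mem_nhdsLT zero_lt_one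
  -- For each finite set of indices the bound `M` survives `r → 1`.
  have hsq : Summable fun n => ‖a n‖ ^ 2 := by
    refine summable_of_sum_le (c := M) (fun n => by positivity) fun s => ?_
    have hlim : Tendsto (fun r : ℝ => ∑ n ∈ s, ‖a n * (r : ℂ) ^ n‖ ^ 2) (𝓝[<] 1)
        (𝓝 (∑ n ∈ s, ‖a n * ((1 : ℝ) : ℂ) ^ n‖ ^ 2)) := by
      refine Tendsto.mono_left (Continuous.tendsto ?_ 1) nhdsWithin_le_nhds
      fun_prop
    have hle := le_of_tendsto hlim (b := M) (by
      filter_upwards [hIoo, hM] with r hr hMr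
      exact (sum_le_hasSum s (fun _ _ => by positivity) (he.hasSum_norm_sq (h r hr))).trans hMr)
    simpa using hle
  have hsum : Summable fun n => a n • e n := by
    have := (he.orthogonalFamily.summable_iff_norm_sq_summable a).2 hsq
    simpa [LinearIsometry.toSpanSingleton_apply] using this
  obtain ⟨y, hy⟩ := hsum
  refine ⟨y, ?_⟩
  have hnorm : ∀ r ∈ Ioo (0 : ℝ) 1, ‖x r - y‖ ^ 2 = ∑' n, ‖a n * (r : ℂ) ^ n - a n‖ ^ 2 := by
    intro r hr
    have h1 := (h r hr).sub hy
    simp only [← sub_smul] at h1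
    exact (he.hasSum_norm_sq h1).tsum_eq.symm
  have hlim : Tendsto (fun r : ℝ => ∑' n, ‖a n * (r : ℂ) ^ n - a n‖ ^ 2) (𝓝[<] 1)
      (𝓝 (∑' _ : ℕ, (0 : ℝ))) := by
    refine tendsto_tsum_of_dominated_convergence hsq (fun n => ?_) ?_
    · have : Continuous fun r : ℝ => ‖a n * (r : ℂ) ^ n - a n‖ ^ 2 := by fun_prop
      have h1 := (this.tendsto 1).mono_left (nhdsWithin_le_nhds (s := Iio 1))
      simpa using h1
    · filter_upwards [hIoo] with r hr n
      have h1 : ‖a n * (r : ℂ) ^ n - a n‖ = ‖a n‖ * (1 - r ^ n) := by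
        have : a n * (r : ℂ) ^ n - a n = a n * ((r ^ n - 1 : ℝ) : ℂ) := by push_cast; ring
        rw [this, norm_mul, Complex.norm_real, Real.norm_eq_abs, abs_sub_comm,
          abs_of_nonneg (sub_nonneg.2 (pow_le_one₀ hr.1.le hr.2.le))]
      have h2 : 0 ≤ r ^ n := pow_nonneg hr.1.le n
      have h3 : r ^ n ≤ 1 := pow_le_one₀ hr.1.le hr.2.le
      rw [h1, Real.norm_eq_abs, abs_of_nonneg (by positivity), mul_pow]
      exact mul_le_of_le_one_right (by positivity) (by nlinarith)
  rw [tsum_zero] at hlim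
  rw [tendsto_iff_norm_sub_tendsto_zero]
  have h4 : Tendsto (fun r => √(‖x r - y‖ ^ 2)) (𝓝[<] 1) (𝓝 √0) := by
    refine (Real.continuous_sqrt.tendsto 0).comp (hlim.congr' ?_)
    filter_upwards [hIoo] with r hr using (hnorm r hr).symm
  simpa using h4

/-- The factor appears because `haarAddCircle` is a probability measure, while the angle runs over
an interval of length `2π`. -/
theorem eLpNorm_haarAddCircle [Fact (0 < 2 * Real.pi)] {f : AddCircle (2 * Real.pi) → ℂ}
    (hf : AEStronglyMeasurable f AddCircle.haarAddCircle) :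
    eLpNorm (fun θ : ℝ => f θ) 2 (volume.restrict (Ioc 0 (2 * Real.pi))) =
      ENNReal.ofReal (2 * Real.pi) ^ (1 / 2 : ℝ) * eLpNorm f 2 AddCircle.haarAddCircle := by
  have hv : AEStronglyMeasurable f volume := by
    rw [AddCircle.volume_eq_smul_haarAddCircle]
    exact hf.smul_measure _
  have hmp := AddCircle.measurePreserving_mk (2 * Real.pi) 0
  rw [zero_add] at hmp
  have h1 := eLpNorm_comp_measurePreserving (p := 2) hv hmp
  rw [AddCircle.volume_eq_smul_haarAddCircle, eLpNorm_smul_measure_of_ne_top (by simp)] at h1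
  simpa [Function.comp_def] using h1

theorem fourier_eq_circlePoint_pow (n : ℕ) (θ : ℝ) :
    fourier (n : ℤ) (θ : AddCircle (2 * Real.pi)) = circlePoint θ ^ n := by
  rw [fourier_coe_apply, circlePoint, ← Complex.exp_nat_mul]
  congr 1
  have : (Real.pi : ℂ) ≠ 0 := Complex.ofReal_ne_zero.2 Real.pi_ne_zero
  push_cast
  field_simp

/-- A function of the Hardy space `H²` has a boundary function in `L²`. -/
theorem exists_hardy_boundary {q : ℂ → ℂ} (hq : DifferentiableOn ℂ q (Metric.ball 0 1))
    {M : ENNReal} (hM : M ≠ ⊤) (hbd : ∀ᶠ r : ℝ in 𝓝[<] 1,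
      eLpNorm (fun θ : ℝ => q (r * circlePoint θ)) 2 (volume.restrict (Ioc 0 (2 * Real.pi))) ≤ M) :
    ∃ v : ℝ → ℂ, MemLp v 2 (volume.restrict (Ioc 0 (2 * Real.pi))) ∧
      Tendsto (fun r : ℝ => eLpNorm (fun θ : ℝ => q (r * circlePoint θ) - v θ) 2
        (volume.restrict (Ioc 0 (2 * Real.pi)))) (𝓝[<] 1) (𝓝 0) := by
  have : Fact (0 < 2 * Real.pi) := ⟨Real.two_pi_pos⟩
  set a : ℕ → ℂ := fun n => ((n.factorial : ℂ))⁻¹ * iteratedDeriv n q 0 with ha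
  have hser : ∀ z ∈ Metric.ball (0 : ℂ) 1, HasSum (fun n => a n * z ^ n) (q z) := by
    intro z hz
    have h1 := Complex.hasSum_taylorSeries_on_ball hq hz
    have h2 : (fun n => a n * z ^ n) =
        fun n => ((n.factorial : ℂ))⁻¹ • (z - 0) ^ n • iteratedDeriv n q 0 := by
      funext n
      simp only [ha, sub_zero, smul_eq_mul]
      ring
    rw [h2]
    exact h1
  have hnorm : ∀ r ∈ Ioo (0 : ℝ) 1, Summable fun n => ‖(a n * (r : ℂ) ^ n) • fourier (T := 2 * Real.pi) (n : ℤ)‖ := by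
    intro r hr
    have hr' : ‖(r : ℂ)‖ < 1 := by
      rw [Complex.norm_real, Real.norm_eq_abs, abs_of_pos hr.1]; exact hr.2
    have := (hser r (mem_ball_zero_iff.2 hr')).summable.norm
    simpa [norm_smul, fourier_norm] using this
  -- The restriction of `q` to the circle of radius `r`, as a uniformly convergent Fourier series.
  -- The same sum can then be read pointwise and in `L²`.
  set C : ℝ → C(AddCircle (2 * Real.pi), ℂ) := fun r =>
    ∑' n : ℕ, (a n * (r : ℂ) ^ n) • fourier (T := 2 * Real.pi) (n : ℤ) with hC
  have hCsum : ∀ r ∈ Ioo (0 : ℝ) 1,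
      HasSum (fun n : ℕ => (a n * (r : ℂ) ^ n) • fourier (T := 2 * Real.pi) (n : ℤ)) (C r) :=
    fun r hr => (hnorm r hr).of_norm.hasSum
  have hCq : ∀ r ∈ Ioo (0 : ℝ) 1, ∀ θ : ℝ, C r θ = q (r * circlePoint θ) := by
    intro r hr θ
    have h1 := (hCsum r hr).mapL (ContinuousMap.evalCLM ℂ (θ : AddCircle (2 * Real.pi)))
    have hmem := ofReal_mul_circlePoint_mem_ball (by rw [abs_of_pos hr.1]; exact hr.2 : |r| < 1) θ
    refine h1.unique ?_
    convert hser _ hmem using 1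
    funext n
    simp only [ContinuousMap.evalCLM_apply, ContinuousMap.smul_apply, smul_eq_mul,
      fourier_eq_circlePoint_pow, mul_pow]
    ring
  set X : ℝ → Lp ℂ 2 (AddCircle.haarAddCircle (T := 2 * Real.pi)) := fun r =>
    ContinuousMap.toLp 2 AddCircle.haarAddCircle ℂ (C r) with hX
  have hXsum : ∀ r ∈ Ioo (0 : ℝ) 1,
      HasSum (fun n : ℕ => (a n * (r : ℂ) ^ n) • fourierLp (T := 2 * Real.pi) 2 (n : ℤ)) (X r) := by
    intro r hr
    have h1 := (hCsum r hr).mapL (ContinuousMap.toLp (E := ℂ) 2 AddCircle.haarAddCircle ℂ)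
    simpa only [map_smul] using h1
  have he : Orthonormal ℂ fun n : ℕ => fourierLp (T := 2 * Real.pi) 2 (n : ℤ) :=
    (orthonormal_fourier (T := 2 * Real.pi)).comp _ Nat.cast_injective
  set κ : ENNReal := ENNReal.ofReal (2 * Real.pi) ^ (1 / 2 : ℝ) with hκ
  have hκ0 : κ ≠ 0 := by
    simp [hκ, Real.pi_pos]
  have hκt : κ ≠ ⊤ := ENNReal.rpow_ne_top_of_nonneg (by norm_num) ENNReal.ofReal_ne_top
  have hXn : ∀ᶠ r in 𝓝[<] (1 : ℝ), κ * ‖X r‖ₑ ≤ M := by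
    filter_upwards [Ioo_mem_nhdsLT (zero_lt_one (α := ℝ)), hbd] with r hr hbr
    refine le_trans (le_of_eq ?_) hbr
    rw [Lp.enorm_def, eLpNorm_congr_ae (ContinuousMap.coeFn_toLp AddCircle.haarAddCircle (C r)),
      ← eLpNorm_haarAddCircle (C r).continuous.aestronglyMeasurable]
    simp only [hCq r hr]
  obtain ⟨y, hy⟩ := he.exists_tendsto_abel (M := ((M / κ).toReal) ^ 2) hXsum (by
    filter_upwards [hXn] with r hr
    have h1 : ‖X r‖ₑ ≤ M / κ := by
      rw [ENNReal.le_div_iff_mul_le (Or.inl hκ0) (Or.inl hκt), mul_comm]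
      exact hr
    have h2 := ENNReal.toReal_mono (ENNReal.div_ne_top hM hκ0) h1
    rw [toReal_enorm] at h2
    gcongr)
  have hymp : AEStronglyMeasurable y AddCircle.haarAddCircle := Lp.aestronglyMeasurable y
  refine ⟨fun θ => y (θ : AddCircle (2 * Real.pi)), ⟨?_, ?_⟩, ?_⟩
  · have hmp := AddCircle.measurePreserving_mk (2 * Real.pi) 0
    rw [zero_add] at hmp
    have hv : AEStronglyMeasurable y volume := by
      rw [AddCircle.volume_eq_smul_haarAddCircle]
      exact hymp.smul_measure _
    exact hv.comp_measurePreserving hmp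
  · rw [eLpNorm_haarAddCircle hymp]
    exact ENNReal.mul_lt_top hκt.lt_top (Lp.eLpNorm_lt_top y)
  · have h1 : Tendsto (fun r => κ * edist (X r) y) (𝓝[<] 1) (𝓝 (κ * 0)) :=
      ENNReal.Tendsto.const_mul (tendsto_iff_edist_tendsto_0.1 hy) (Or.inr hκt)
    rw [mul_zero] at h1
    refine h1.congr' ?_
    filter_upwards [Ioo_mem_nhdsLT (zero_lt_one (α := ℝ))] with r hr
    have h2 : eLpNorm (X r - y : AddCircle (2 * Real.pi) → ℂ) 2 AddCircle.haarAddCircle =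
        eLpNorm (fun t => C r t - y t) 2 AddCircle.haarAddCircle := by
      refine eLpNorm_congr_ae ?_
      filter_upwards [ContinuousMap.coeFn_toLp (𝕜 := ℂ) (p := 2) AddCircle.haarAddCircle (C r)]
        with t ht
      rw [Pi.sub_apply, ht]
    have h3 := eLpNorm_haarAddCircle (f := fun t => C r t - y t)
      ((C r).continuous.aestronglyMeasurable.sub hymp)
    simp only [hCq r hr] at h3
    rw [Lp.edist_def, h2, h3]

/-! ### Variation of smooth arcs -/

/-- Increments of `f` are bounded by those of the monotone function `m`, the integral of the speed,
whose variation is its total increment. -/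
theorem eVariationOn_le_lintegral_enorm {f f' : ℝ → ℂ} {a b : ℝ} (hab : a ≤ b)
    (hf : ∀ x, HasDerivAt f (f' x) x) (hc : Continuous f') :
    eVariationOn f (Icc a b) ≤ ∫⁻ x in Icc a b, ‖f' x‖ₑ := by
  set m : ℝ → ℝ := fun x => ∫ t in a..x, ‖f' t‖ with hm
  have hint : ∀ x y, IntervalIntegrable (fun t => ‖f' t‖) volume x y :=
    fun x y => hc.norm.intervalIntegrable x y
  have hsub : ∀ x y, m y - m x = ∫ t in x..y, ‖f' t‖ := fun x y =>
    intervalIntegral.integral_interval_sub_left (hint _ _) (hint _ _)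
  have hmono : Monotone m := fun x y hxy => by
    have h1 := hsub x y
    have h2 : 0 ≤ ∫ t in x..y, ‖f' t‖ :=
      intervalIntegral.integral_nonneg hxy fun _ _ => norm_nonneg _
    linarith
  have hdist : ∀ x y, x ≤ y → edist (f y) (f x) ≤ edist (m y) (m x) := by
    intro x y hxy
    rw [edist_dist, edist_dist]
    refine ENNReal.ofReal_le_ofReal ?_
    rw [dist_eq_norm, Real.dist_eq, hsub,
      ← intervalIntegral.integral_eq_sub_of_hasDerivAt (fun t _ => hf t)
        (hc.intervalIntegrable x y)]
    exact (intervalIntegral.norm_integral_le_integral_norm hxy).trans (le_abs_self _)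
  have h1 : eVariationOn f (Icc a b) ≤ eVariationOn m (Icc a b) := by
    refine iSup_le fun p => ?_
    refine le_trans (Finset.sum_le_sum fun i _ => hdist _ _ (p.2.2.1 (Nat.le_succ i))) ?_
    exact eVariationOn.sum_le p.2.2.1 p.2.2.2
  have h2 := (hmono.monotoneOn (Icc a b)).eVariationOn_eq (left_mem_Icc.2 hab)
    (right_mem_Icc.2 hab)
  rw [inter_self] at h2
  refine h1.trans (h2.le.trans ?_)
  rw [hsub, intervalIntegral.integral_of_le hab, ← integral_Icc_eq_integral_Ioc,
    ofReal_integral_norm_eq_lintegral_enorm hc.integrableOn_Icc]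

/-- The variation function `m` is monotone and increases at least as fast as `f` moves, so `‖f'‖ ≤
m'` almost everywhere. The integral of `m'` is at most the increment of `m`, by Lebesgue's theorem
on monotone functions. -/
theorem lintegral_enorm_le_eVariationOn {f f' : ℝ → ℂ} {a b : ℝ} (hab : a ≤ b)
    (hf : ∀ x, HasDerivAt f (f' x) x) (hc : Continuous f') :
    ∫⁻ x in Icc a b, ‖f' x‖ₑ ≤ eVariationOn f (Icc a b) := by
  by_cases htop : eVariationOn f (Icc a b) = ⊤
  · rw [htop]
    exact le_top
  have hbv : LocallyBoundedVariationOn f (Icc a b) :=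
    BoundedVariationOn.locallyBoundedVariationOn htop
  set m : ℝ → ℝ := variationOnFromTo f (Icc a b) a with hm
  have ha : a ∈ Icc a b := left_mem_Icc.2 hab
  have hb : b ∈ Icc a b := right_mem_Icc.2 hab
  have hmono : MonotoneOn m (Icc a b) := variationOnFromTo.monotoneOn hbv ha
  have hdist : ∀ x ∈ Icc a b, ∀ y ∈ Icc a b, x ≤ y → ‖f y - f x‖ ≤ m y - m x := by
    intro x hx y hy hxy
    rw [hm, variationOnFromTo.sub_right hbv ha hy hx, variationOnFromTo.eq_of_le _ _ hxy,
      ← dist_eq_norm, dist_edist]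
    refine ENNReal.toReal_mono (hbv x y hx hy) ?_
    exact eVariationOn.edist_le f ⟨hy, hxy, le_rfl⟩ ⟨hx, le_rfl, hxy⟩
  have hder : ∀ᵐ x, x ∈ Ioo a b → ‖f' x‖ ≤ deriv m x := by
    filter_upwards [hmono.ae_differentiableWithinAt_of_mem] with x hx hxI
    have hxd : HasDerivAt m (deriv m x) x :=
      ((hx (Ioo_subset_Icc_self hxI)).differentiableAt
        (Icc_mem_nhds hxI.1 hxI.2)).hasDerivAt
    have hIoi : Ioi x ⊆ {x}ᶜ := fun y hy => (mem_Ioi.1 hy).ne'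
    have h1 := ((hasDerivAt_iff_tendsto_slope.1 (hf x)).mono_left
      (nhdsWithin_mono x hIoi)).norm
    have h2 := (hasDerivAt_iff_tendsto_slope.1 hxd).mono_left
      (nhdsWithin_mono x hIoi)
    refine le_of_tendsto_of_tendsto h1 h2 ?_
    filter_upwards [Ioo_mem_nhdsGT hxI.2] with y hy
    have h3 := hdist x (Ioo_subset_Icc_self hxI) y ⟨(hxI.1.trans hy.1).le, hy.2.le⟩ hy.1.le
    have h4 : 0 < y - x := sub_pos.2 hy.1
    rw [slope_def_module, slope_def_module, norm_smul, smul_eq_mul, norm_inv, Real.norm_eq_abs,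
      abs_of_pos h4]
    gcongr
  have hmono' : MonotoneOn m (uIcc a b) := by rwa [uIcc_of_le hab]
  have h1 : ∫ x in a..b, ‖f' x‖ ≤ ∫ x in a..b, deriv m x := by
    refine intervalIntegral.integral_mono_ae_restrict hab (hc.norm.intervalIntegrable _ _)
      hmono'.intervalIntegrable_deriv ?_
    rw [← restrict_Ioo_eq_restrict_Icc]
    exact (ae_restrict_iff' measurableSet_Ioo).2 hder
  have h2 : ∫ x in a..b, deriv m x ≤ m b - m a := by
    have := hmono'.intervalIntegral_deriv_mem_uIcc
    rw [uIcc_of_le (sub_nonneg.2 (hmono ha hb hab))] at this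
    exact this.2
  have h3 : m b - m a = (eVariationOn f (Icc a b)).toReal := by
    rw [hm, variationOnFromTo.self, sub_zero, variationOnFromTo.eq_of_le _ _ hab, inter_self]
  rw [← ofReal_integral_norm_eq_lintegral_enorm hc.integrableOn_Icc,
    integral_Icc_eq_integral_Ioc, ← intervalIntegral.integral_of_le hab]
  exact ENNReal.ofReal_le_of_le_toReal ((h1.trans h2).trans h3.le)

/-- The variation of a holomorphic function on a circle is at most that on the unit circle. -/
theorem eVariationOn_circle_le {γ : ℂ → ℂ} (hγ : DiffContOnCl ℂ γ (Metric.ball 0 1)) {M : ℝ}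
    (hM : 0 ≤ M)
    (hvar : ∀ α, eVariationOn (fun θ => γ (circlePoint θ)) (Icc α (α + 2 * Real.pi)) ≤
      ENNReal.ofReal M) {r : ℝ} (hr : |r| ≤ 1) :
    eVariationOn (fun θ => γ (r * circlePoint θ)) (Icc 0 (2 * Real.pi)) ≤ ENNReal.ofReal M := by
  refine iSup_le ?_
  rintro ⟨n, u, hu, us⟩
  set D : ℕ → ℂ → ℂ := fun i z => γ (z * circlePoint (u (i + 1))) - γ (z * circlePoint (u i)) with hD
  have hsum : ∀ z, ∑ i ∈ Finset.range n, edist (γ (z * circlePoint (u (i + 1))))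
      (γ (z * circlePoint (u i))) = ENNReal.ofReal (∑ i ∈ Finset.range n, ‖D i z‖) := by
    intro z
    rw [ENNReal.ofReal_sum_of_nonneg fun _ _ => norm_nonneg _]
    simp only [edist_dist, dist_eq_norm, hD]
  -- A point `z = circlePoint α` only shifts the partition by `α`; this is why the variation is
  -- bounded on every interval of length `2π`.
  have hbdry : ∀ z, ‖z‖ = 1 → ∑ i ∈ Finset.range n, ‖D i z‖ ≤ M := by
    intro z hz
    obtain ⟨α, rfl⟩ : ∃ α, circlePoint α = z :=
      ⟨z.arg, by simpa [circlePoint, hz] using Complex.norm_mul_exp_arg_mul_I z⟩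
    rw [← ENNReal.ofReal_le_ofReal_iff hM, ← hsum]
    simp only [← circlePoint_add]
    refine le_trans ?_ (hvar α)
    exact eVariationOn.sum_le (f := fun θ => γ (circlePoint θ)) (u := fun i => α + u i)
      (fun i j hij => add_le_add_right (hu hij) α)
      fun i => ⟨by linarith [(us i).1], by linarith [(us i).2]⟩
  -- The phases are frozen at the point `r`, so that `∑ s i * D i z` is holomorphic in `z` and
  -- equals the sum of norms at `z = r`; the maximum principle then applies. If `D i r = 0`,
  -- division by zero gives `s i = 0`, which is harmless.
  set s : ℕ → ℂ := fun i => (starRingEnd ℂ) (D i r) / ‖D i r‖ with hs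
  have hs1 : ∀ i, ‖s i‖ ≤ 1 := by
    intro i
    rw [hs, norm_div, RCLike.norm_conj, Complex.norm_real, norm_norm]
    exact div_self_le_one _
  have hs2 : ∀ i, s i * D i r = ‖D i r‖ := by
    intro i
    rcases eq_or_ne (D i r) 0 with h | h
    · simp [h]
    · have : (‖D i r‖ : ℂ) ≠ 0 := Complex.ofReal_ne_zero.2 (norm_ne_zero_iff.2 h)
      rw [hs, div_mul_eq_mul_div, Complex.conj_mul', sq, mul_div_assoc, div_self this, mul_one]
  have hcomp : ∀ t, DiffContOnCl ℂ (fun z => γ (z * circlePoint t)) (Metric.ball 0 1) := by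
    intro t
    refine hγ.comp (g := fun z => z * circlePoint t) (Differentiable.diffContOnCl (by fun_prop)) ?_
    intro z hz
    simpa [norm_circlePoint] using hz
  have hG : DiffContOnCl ℂ (fun z => ∑ i ∈ Finset.range n, s i * D i z) (Metric.ball 0 1) := by
    have hDi : ∀ i, DiffContOnCl ℂ (D i) (Metric.ball 0 1) := fun i => (hcomp _).sub (hcomp _)
    exact ⟨DifferentiableOn.fun_sum fun i _ => (hDi i).1.const_mul _,
      continuousOn_finsetSum _ fun i _ => continuousOn_const.mul (hDi i).2⟩
  have hmax := Complex.norm_le_of_forall_mem_frontier_norm_le Metric.isBounded_ball hG (C := M)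
    (fun z hz => by
      rw [frontier_ball _ one_ne_zero, mem_sphere_zero_iff_norm] at hz
      refine le_trans (norm_sum_le _ _) (le_trans (Finset.sum_le_sum fun i _ => ?_) (hbdry z hz))
      rw [norm_mul]
      exact mul_le_of_le_one_left (norm_nonneg _) (hs1 i))
    (z := r) (by
      rw [closure_ball _ one_ne_zero, mem_closedBall_zero_iff, Complex.norm_real]
      exact hr)
  simp only [hs2, ← Complex.ofReal_sum, Complex.norm_real] at hmax
  rw [hsum]
  exact ENNReal.ofReal_le_ofReal ((le_abs_self _).trans hmax)

/-- Needed because the change of parameter between the two curves is monotone only after a base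
point is removed. -/
theorem eVariationOn_Icc_eq_Ioo {E : Type*} [PseudoEMetricSpace E] {f : ℝ → E} {a b : ℝ}
    (hab : a < b) (hf : ContinuousOn f (Icc a b)) :
    eVariationOn f (Icc a b) = eVariationOn f (Ioo a b) := by
  have h1 : eVariationOn f (Icc a b ∩ Ioi a) = eVariationOn f (Icc a b ∩ Ici a) := by
    refine eVariationOn.eVariationOn_inter_Ioi_eq_inter_Ici_of_continuousWithinAt ?_
      ((hf a (left_mem_Icc.2 hab.le)).mono inter_subset_left)
    have : Icc a b ∩ Ioi a = Ioc a b := by ext; simp; grind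
    rw [this, nhdsWithin_Ioc_eq_nhdsGT hab]
    infer_instance
  have h2 : eVariationOn f (Ioc a b ∩ Iio b) = eVariationOn f (Ioc a b ∩ Iic b) := by
    refine eVariationOn.eVariationOn_inter_Iio_eq_inter_Iic_of_continuousWithinAt ?_
      ((hf b (right_mem_Icc.2 hab.le)).mono (inter_subset_left.trans Ioc_subset_Icc_self))
    have : Ioc a b ∩ Iio b = Ioo a b := by ext; simp; grind
    rw [this, nhdsWithin_Ioo_eq_nhdsLT hab]
    infer_instance
  have e1 : Icc a b ∩ Ioi a = Ioc a b := by ext; simp; grind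
  have e2 : Icc a b ∩ Ici a = Icc a b := inter_eq_left.2 fun x hx => hx.1
  have e3 : Ioc a b ∩ Iio b = Ioo a b := by ext; simp; grind
  have e4 : Ioc a b ∩ Iic b = Ioc a b := inter_eq_left.2 fun x hx => hx.2
  rw [e1, e2] at h1
  rw [e3, e4] at h2
  rw [← h1, ← h2]

/-! ### Comparison of two parametrizations of a closed curve -/

theorem injOn_Ico_of_periodic {X : Type*} {c : ℝ → X} {L : ℝ} (hL : 0 < L)
    (hc : Function.Periodic c L) (hinj : InjOn c (Ico 0 L)) (a : ℝ) :
    InjOn c (Ico a (a + L)) := by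
  intro x hx y hy hxy
  have hmod : ∀ t, c (toIcoMod hL 0 t) = c t := fun t => by
    rw [toIcoMod]
    exact hc.sub_zsmul_eq _
  have hmem : ∀ t, toIcoMod hL 0 t ∈ Ico 0 L := fun t => by
    simpa using toIcoMod_mem_Ico hL 0 t
  have h1 := hinj (hmem x) (hmem y) (by rw [hmod, hmod, hxy])
  have h2 : toIcoMod hL a x = toIcoMod hL a y := (toIcoMod_inj hL).2 ((toIcoMod_inj hL).1 h1)
  rwa [(toIcoMod_eq_self hL).2 hx, (toIcoMod_eq_self hL).2 hy] at h2

/-- Two simple periodic parametrizations of the same closed curve differ, off one point, by a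
strictly monotone or antitone change of the parameter. -/
theorem exists_reparametrization {X : Type*} [TopologicalSpace X] [T2Space X] {c φ : ℝ → X}
    {L T : ℝ} (hL : 0 < L) (hT : 0 < T) (hc : Continuous c) (hφ : Continuous φ)
    (hcp : Function.Periodic c L) (hφp : Function.Periodic φ T) (hci : InjOn c (Ico 0 L))
    (hφi : InjOn φ (Ico 0 T)) (hr : range c = range φ) (α : ℝ) :
    ∃ (l : ℝ) (τ : ℝ → ℝ), c l = φ α ∧ BijOn τ (Ioo l (l + L)) (Ioo α (α + T)) ∧
      (∀ x ∈ Ioo l (l + L), φ (τ x) = c x) ∧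
      (StrictMonoOn τ (Ioo l (l + L)) ∨ StrictAntiOn τ (Ioo l (l + L))) := by
  obtain ⟨l, hl⟩ : φ α ∈ range c := hr ▸ mem_range_self α
  have hci' := injOn_Ico_of_periodic hL hcp hci l
  have hφi' := injOn_Ico_of_periodic hT hφp hφi α
  have hlmem : l ∈ Ico l (l + L) := ⟨le_rfl, by linarith⟩
  have hαmem : α ∈ Ico α (α + T) := ⟨le_rfl, by linarith⟩
  have hex : ∀ x, ∃ θ ∈ Ico α (α + T), φ θ = c x := by
    intro x
    obtain ⟨θ, hθ⟩ : c x ∈ range φ := hr ▸ mem_range_self x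
    obtain ⟨y, hy, hy2⟩ := hφp.exists_mem_Ico hT θ α
    exact ⟨y, hy, by rw [← hy2, hθ]⟩
  choose τ hτ hτc using hex
  have hτm : MapsTo τ (Ioo l (l + L)) (Ioo α (α + T)) := by
    intro x hx
    refine ⟨lt_of_le_of_ne (hτ x).1 fun h => ?_, (hτ x).2⟩
    have h1 := hτc x
    rw [← h, ← hl] at h1
    exact hx.1.ne (hci' hlmem (Ioo_subset_Ico_self hx) h1)
  have hτi : InjOn τ (Ioo l (l + L)) := fun x hx y hy hxy =>
    hci' (Ioo_subset_Ico_self hx) (Ioo_subset_Ico_self hy) (by rw [← hτc, ← hτc, hxy])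
  have hτs : SurjOn τ (Ioo l (l + L)) (Ioo α (α + T)) := by
    intro θ hθ
    obtain ⟨x, hx⟩ : φ θ ∈ range c := hr ▸ mem_range_self θ
    obtain ⟨y, hy, hy2⟩ := hcp.exists_mem_Ico hL x l
    have hyc : c y = φ θ := by rw [← hy2, hx]
    refine ⟨y, ⟨lt_of_le_of_ne hy.1 fun h => ?_, hy.2⟩, ?_⟩
    · rw [← h, hl] at hyc
      exact hθ.1.ne (hφi' hαmem (Ioo_subset_Ico_self hθ) hyc)
    · exact hφi' (hτ y) (Ioo_subset_Ico_self hθ) (by rw [hτc, hyc])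
  -- Continuity by closed sets: `φ` maps compact subsets of `[α, α + T]` to closed sets. The extra
  -- endpoint `α + T` does no harm, as its image is the base point, which `c` avoids on the open
  -- interval.
  have hcont : ContinuousOn τ (Ioo l (l + L)) := by
    rw [continuousOn_iff_isClosed]
    intro K hK
    refine ⟨c ⁻¹' (φ '' (K ∩ Icc α (α + T))),
      (((isCompact_Icc.inter_left hK).image hφ).isClosed.preimage hc), ?_⟩
    ext x
    refine and_congr_left fun hx => ⟨fun h => ?_, ?_⟩
    · exact ⟨τ x, ⟨h, Ico_subset_Icc_self (hτ x)⟩, hτc x⟩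
    · rintro ⟨θ, ⟨hθK, hθ⟩, hθx⟩
      have hne : c x ≠ φ α := fun h => hx.1.ne
        (hci' hlmem (Ioo_subset_Ico_self hx) (hl.trans h.symm))
      have hθT : θ ≠ α + T := fun h => hne (by rw [← hθx, h, hφp])
      have : τ x = θ := hφi' (hτ x) ⟨hθ.1, lt_of_le_of_ne hθ.2 hθT⟩ ((hτc x).trans hθx.symm)
      exact mem_preimage.2 (this ▸ hθK)
  exact ⟨l, τ, hl, ⟨hτm, hτi, hτs⟩, fun x _ => hτc x,
    hcont.strictMonoOn_of_injOn_Ioo (by linarith) hτi⟩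

theorem eVariationOn_image_eq {E : Type*} [PseudoEMetricSpace E] {c φ : ℝ → E} {τ : ℝ → ℝ}
    {I s : Set ℝ} (hτ : ∀ x ∈ I, φ (τ x) = c x) (hmono : StrictMonoOn τ I ∨ StrictAntiOn τ I)
    (hs : s ⊆ I) : eVariationOn φ (τ '' s) = eVariationOn c s := by
  have h1 : eVariationOn (φ ∘ τ) s = eVariationOn c s :=
    eVariationOn.congr fun x hx => hτ x (hs hx)
  rw [← h1]
  rcases hmono with h | h
  · exact (eVariationOn.comp_eq_of_monotoneOn φ τ (h.monotoneOn.mono hs)).symm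
  · exact (eVariationOn.comp_eq_of_antitoneOn φ τ (h.antitoneOn.mono hs)).symm

theorem eVariationOn_Icc_of_hasUnitSpeedOn {c : ℝ → ℂ} (hc : HasUnitSpeedOn c univ) {x y : ℝ} :
    eVariationOn c (Icc x y) = ENNReal.ofReal (y - x) := by
  simpa using hc (mem_univ x) (mem_univ y)

/-- A chord is no longer than its arc, so `c` is 1-Lipschitz. -/
theorem continuous_of_hasUnitSpeedOn {c : ℝ → ℂ} (hc : HasUnitSpeedOn c univ) : Continuous c := by
  have h : ∀ x y : ℝ, x ≤ y → edist (c x) (c y) ≤ edist x y := by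
    intro x y hxy
    refine (eVariationOn.edist_le c (left_mem_Icc.2 hxy) (right_mem_Icc.2 hxy)).trans ?_
    rw [eVariationOn_Icc_of_hasUnitSpeedOn hc, edist_comm, edist_dist, Real.dist_eq,
      abs_of_nonneg (sub_nonneg.2 hxy)]
  refine LipschitzWith.continuous (K := 1) fun x y => ?_
  rw [ENNReal.coe_one, one_mul]
  rcases le_total x y with hxy | hxy
  · exact h x y hxy
  · rw [edist_comm, edist_comm x]
    exact h y x hxy

/-- The preimage of an interval under the change of parameter is no longer than the
corresponding arc. -/
theorem volume_preimage_le_eVariationOn {c φ : ℝ → ℂ} (hc : HasUnitSpeedOn c univ) {τ : ℝ → ℝ}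
    {l l' α β : ℝ} (hbij : BijOn τ (Ioo l l') (Ioo α β)) (hτ : ∀ x ∈ Ioo l l', φ (τ x) = c x)
    (hmono : StrictMonoOn τ (Ioo l l') ∨ StrictAntiOn τ (Ioo l l')) {a b : ℝ}
    (ha : a ∈ Ioo α β) (hb : b ∈ Ioo α β) :
    volume (τ ⁻¹' Icc a b ∩ Ioo l l') ≤ eVariationOn φ (Icc a b) := by
  rcases lt_or_ge b a with hab | hab
  · simp [Icc_eq_empty_of_lt hab]
  obtain ⟨x, hx, rfl⟩ := hbij.2.2 ha
  obtain ⟨y, hy, rfl⟩ := hbij.2.2 hb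
  -- The pair `(p, q)` is `(x, y)` for increasing `τ` and `(y, x)` for decreasing `τ`.
  have key : ∀ p ∈ Ioo l l', ∀ q ∈ Ioo l l', τ ⁻¹' Icc (τ x) (τ y) ∩ Ioo l l' ⊆ Icc p q →
      MapsTo τ (Icc p q) (Icc (τ x) (τ y)) →
      volume (τ ⁻¹' Icc (τ x) (τ y) ∩ Ioo l l') ≤ eVariationOn φ (Icc (τ x) (τ y)) := by
    intro p hp q hq h1 h2
    calc volume (τ ⁻¹' Icc (τ x) (τ y) ∩ Ioo l l') ≤ volume (Icc p q) := measure_mono h1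
      _ = eVariationOn c (Icc p q) := by
        rw [Real.volume_Icc, eVariationOn_Icc_of_hasUnitSpeedOn hc]
      _ = eVariationOn φ (τ '' Icc p q) :=
        (eVariationOn_image_eq hτ hmono (Icc_subset_Ioo hp.1 hq.2)).symm
      _ ≤ _ := eVariationOn.mono φ h2.image_subset
  rcases hmono with h | h
  · refine key x hx y hy (fun z hz => ?_) fun z hz => ?_
    · exact ⟨(h.le_iff_le hx hz.2).1 hz.1.1, (h.le_iff_le hz.2 hy).1 hz.1.2⟩
    · have hzI : z ∈ Ioo l l' := Icc_subset_Ioo hx.1 hy.2 hz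
      exact ⟨(h.le_iff_le hx hzI).2 hz.1, (h.le_iff_le hzI hy).2 hz.2⟩
  · refine key y hy x hx (fun z hz => ?_) fun z hz => ?_
    · exact ⟨(h.le_iff_ge hz.2 hy).1 hz.1.2, (h.le_iff_ge hx hz.2).1 hz.1.1⟩
    · have hzI : z ∈ Ioo l l' := Icc_subset_Ioo hy.1 hx.2 hz
      exact ⟨(h.le_iff_ge hx hzI).2 hz.2, (h.le_iff_ge hzI hy).2 hz.1⟩

/-- A measure that is dominated by a locally finite measure `μ` on the small intervals around the
points of `s` is dominated by `μ` on `s`. -/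
theorem measure_le_of_eventually_closedBall_le {ν μ : Measure ℝ} [IsFiniteMeasure ν]
    [IsLocallyFiniteMeasure μ] {s : Set ℝ}
    (h : ∀ x ∈ s, ∀ᶠ r in 𝓝[>] (0 : ℝ), ν (Metric.closedBall x r) ≤ μ (Metric.closedBall x r)) :
    ν s ≤ μ s :=
  -- The Besicovitch covering theorem for `ν` itself: the required absolute continuity is then
  -- trivial.
  (Besicovitch.vitaliFamily ν).measure_le_of_frequently_le μ Measure.AbsolutelyContinuous.rfl s
    fun x hx => (Besicovitch.tendsto_filterAt ν x).frequently (h x hx).frequently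

/-! ### The theorem of F. and M. Riesz for conformal maps -/

theorem eLpNorm_two_sq {μ : Measure ℝ} (f : ℝ → ℂ) : eLpNorm f 2 μ ^ 2 = ∫⁻ x, ‖f x‖ₑ ^ 2 ∂μ := by
  have h := eLpNorm_nnreal_pow_eq_lintegral (f := f) (μ := μ) (p := 2) two_ne_zero
  simp only [NNReal.coe_ofNat, ENNReal.coe_ofNat, ENNReal.rpow_two] at h
  exact h

/-- Variation is lower semicontinuous under pointwise convergence, while the upper bounds converge
because `qr r` tends to `v` in `L²`. -/
theorem eVariationOn_le_of_hardy {φ : ℝ → ℂ} {φr qr : ℝ → ℝ → ℂ} {v : ℝ → ℂ} {a b : ℝ} {S : Set ℝ}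
    (hS : Icc a b ⊆ S)
    (hlim : ∀ θ, Tendsto (fun r => φr r θ) (𝓝[<] 1) (𝓝 (φ θ)))
    (hq : ∀ᶠ r in 𝓝[<] (1 : ℝ), Continuous (qr r))
    (hle : ∀ᶠ r in 𝓝[<] (1 : ℝ), eVariationOn (φr r) (Icc a b) ≤ ∫⁻ θ in Icc a b, ‖qr r θ‖ₑ ^ 2)
    (hv : AEStronglyMeasurable v (volume.restrict S))
    (htend : Tendsto (fun r => eLpNorm (fun θ => qr r θ - v θ) 2 (volume.restrict S))
      (𝓝[<] 1) (𝓝 0)) :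
    eVariationOn φ (Icc a b) ≤ ∫⁻ θ in Icc a b, ‖v θ‖ₑ ^ 2 := by
  have hvI : AEStronglyMeasurable v (volume.restrict (Icc a b)) :=
    hv.mono_measure (Measure.restrict_mono hS le_rfl)
  refine le_of_forall_lt fun x hx => ?_
  obtain ⟨y, hxy, hy⟩ := exists_between hx
  refine lt_of_lt_of_le hxy ?_
  have h1 := eVariationOn.lowerSemicontinuous_aux (fun θ _ => hlim θ) hy
  have h2 : Tendsto (fun r => (eLpNorm (fun θ => qr r θ - v θ) 2 (volume.restrict S) +
      eLpNorm v 2 (volume.restrict (Icc a b))) ^ 2) (𝓝[<] 1)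
      (𝓝 ((0 + eLpNorm v 2 (volume.restrict (Icc a b))) ^ 2)) :=
    ENNReal.Tendsto.pow (htend.add tendsto_const_nhds)
  rw [zero_add, eLpNorm_two_sq] at h2
  refine ge_of_tendsto h2 ?_
  filter_upwards [h1, hq, hle] with r hr1 hr2 hr3
  refine (hr1.le.trans hr3).trans ?_
  rw [← eLpNorm_two_sq]
  gcongr
  have h3 : qr r = (fun θ => qr r θ - v θ) + v := by
    funext θ
    simp
  calc eLpNorm (qr r) 2 (volume.restrict (Icc a b))
      = eLpNorm ((fun θ => qr r θ - v θ) + v) 2 (volume.restrict (Icc a b)) := by rw [← h3]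
    _ ≤ eLpNorm (fun θ => qr r θ - v θ) 2 (volume.restrict (Icc a b)) +
        eLpNorm v 2 (volume.restrict (Icc a b)) :=
      eLpNorm_add_le (hr2.aestronglyMeasurable.sub hvI) hvI (by norm_num)
    _ ≤ _ := by
      gcongr

/-- If a conformal map of the disk is continuous up to the circle, with a boundary curve of
bounded variation, then its variation on arcs is dominated by an absolutely continuous measure. -/
theorem exists_measure_eVariationOn_le {γ : ℂ → ℂ}
    (hd : DifferentiableOn ℂ γ (Metric.ball 0 1)) (hc : ContinuousOn γ (Metric.closedBall 0 1))
    (hinj : InjOn γ (Metric.ball 0 1)) {M : ℝ} (hM : 0 ≤ M)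
    (hvar : ∀ α, eVariationOn (fun θ => γ (circlePoint θ)) (Icc α (α + 2 * Real.pi)) ≤
      ENNReal.ofReal M) :
    ∃ μ : Measure ℝ, IsFiniteMeasure μ ∧ μ ≪ volume ∧ ∀ a b, 0 < a → b < 2 * Real.pi →
      eVariationOn (fun θ => γ (circlePoint θ)) (Icc a b) ≤ μ (Icc a b) := by
  -- Radii above `1/2` allow the factor `r` in `‖φ' r θ‖ = r ‖q‖²` to be removed at the cost of a
  -- constant `2`.
  have hIoo : Ioo (1 / 2 : ℝ) 1 ∈ 𝓝[<] (1 : ℝ) := Ioo_mem_nhdsLT (by norm_num)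
  have hball : ∀ r ∈ Ioo (1 / 2 : ℝ) 1, ∀ θ, (r : ℂ) * circlePoint θ ∈ Metric.ball (0 : ℂ) 1 :=
    fun r hr θ => ofReal_mul_circlePoint_mem_ball
      (by rw [abs_of_pos (by linarith [hr.1])]; exact hr.2) θ
  have hcl : DiffContOnCl ℂ γ (Metric.ball 0 1) :=
    ⟨hd, by rwa [closure_ball _ one_ne_zero]⟩
  have hd' : DifferentiableOn ℂ (deriv γ) (Metric.ball 0 1) := hd.deriv Metric.isOpen_ball
  obtain ⟨q, hqd, hq⟩ := exists_sq_eq_of_ne_zero one_pos hd'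
    fun z hz => deriv_ne_zero_of_injOn Metric.isOpen_ball hd hinj hz
  set φ' : ℝ → ℝ → ℂ := fun r θ => deriv γ (r * circlePoint θ) * (r * (Complex.I * circlePoint θ))
    with hφ'
  have hcirc : ∀ r ∈ Ioo (1 / 2 : ℝ) 1, ∀ {g : ℂ → ℂ}, DifferentiableOn ℂ g (Metric.ball 0 1) →
      Continuous fun θ : ℝ => g (r * circlePoint θ) := fun r hr g hg =>
    hg.continuousOn.comp_continuous (continuous_const.mul continuous_circlePoint) (hball r hr)
  have hder : ∀ r ∈ Ioo (1 / 2 : ℝ) 1, ∀ θ,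
      HasDerivAt (fun θ : ℝ => γ (r * circlePoint θ)) (φ' r θ) θ := by
    intro r hr θ
    have h1 := (hd.differentiableAt (Metric.isOpen_ball.mem_nhds (hball r hr θ))).hasDerivAt
    exact HasDerivAt.comp θ h1 ((hasDerivAt_circlePoint θ).const_mul (r : ℂ))
  have hcont : ∀ r ∈ Ioo (1 / 2 : ℝ) 1, Continuous (φ' r) := fun r hr =>
    (hcirc r hr hd').mul (continuous_const.mul (continuous_const.mul continuous_circlePoint))
  have hnorm : ∀ r ∈ Ioo (1 / 2 : ℝ) 1, ∀ θ,
      ‖φ' r θ‖ₑ = ENNReal.ofReal r * ‖q (r * circlePoint θ)‖ₑ ^ 2 := by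
    intro r hr θ
    have hr0 : 0 ≤ r := by linarith [hr.1]
    have h1 : ‖φ' r θ‖ = r * ‖q (r * circlePoint θ)‖ ^ 2 := by
      simp only [hφ', ← hq _ (hball r hr θ), norm_mul, norm_pow, norm_circlePoint, Complex.norm_I,
        Complex.norm_real, Real.norm_eq_abs, abs_of_nonneg hr0]
      ring
    rw [← ofReal_norm, h1, ENNReal.ofReal_mul hr0, ENNReal.ofReal_pow (norm_nonneg _),
      ofReal_norm]
  -- The maximum with `1` turns a bound for the squared norm into one for the norm without taking a
  -- root.
  have hbound : ∀ r ∈ Ioo (1 / 2 : ℝ) 1, eLpNorm (fun θ : ℝ => q (r * circlePoint θ)) 2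
      (volume.restrict (Ioc 0 (2 * Real.pi))) ≤ max 1 (2 * ENNReal.ofReal M) := by
    intro r hr
    have h1 : ∫⁻ θ in Ioc 0 (2 * Real.pi), ‖φ' r θ‖ₑ ≤ ENNReal.ofReal M :=
      calc ∫⁻ θ in Ioc 0 (2 * Real.pi), ‖φ' r θ‖ₑ
          ≤ ∫⁻ θ in Icc 0 (2 * Real.pi), ‖φ' r θ‖ₑ := lintegral_mono_set Ioc_subset_Icc_self
        _ ≤ eVariationOn (fun θ : ℝ => γ (r * circlePoint θ)) (Icc 0 (2 * Real.pi)) :=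
          lintegral_enorm_le_eVariationOn Real.two_pi_pos.le (hder r hr) (hcont r hr)
        _ ≤ ENNReal.ofReal M := eVariationOn_circle_le hcl hM hvar
          (by rw [abs_of_pos (by linarith [hr.1])]; exact hr.2.le)
    have h2 : ∫⁻ θ in Ioc 0 (2 * Real.pi), ‖q (r * circlePoint θ)‖ₑ ^ 2 ≤
        2 * ENNReal.ofReal M := by
      calc ∫⁻ θ in Ioc 0 (2 * Real.pi), ‖q (r * circlePoint θ)‖ₑ ^ 2
          ≤ ∫⁻ θ in Ioc 0 (2 * Real.pi), 2 * ‖φ' r θ‖ₑ := by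
            refine lintegral_mono fun θ => ?_
            rw [hnorm r hr, ← mul_assoc]
            refine le_mul_of_one_le_left (zero_le) ?_
            have : (2 : ENNReal) = ENNReal.ofReal 2 := by simp
            rw [this, ← ENNReal.ofReal_mul (by norm_num), ENNReal.one_le_ofReal]
            linarith [hr.1]
        _ ≤ 2 * ENNReal.ofReal M := by
          rw [lintegral_const_mul' _ _ (by norm_num)]
          gcongr
    rw [← eLpNorm_two_sq] at h2
    rcases le_total (eLpNorm (fun θ : ℝ => q (r * circlePoint θ)) 2
      (volume.restrict (Ioc 0 (2 * Real.pi)))) 1 with h | h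
    · exact h.trans (le_max_left _ _)
    · refine le_trans ?_ (h2.trans (le_max_right _ _))
      exact le_self_pow h two_ne_zero
  obtain ⟨v, hv, hvt⟩ := exists_hardy_boundary hqd (M := max 1 (2 * ENNReal.ofReal M))
    (by
      refine (max_lt ENNReal.one_lt_top ?_).ne
      exact ENNReal.mul_lt_top (by norm_num) ENNReal.ofReal_lt_top)
    (by filter_upwards [hIoo] with r hr using hbound r hr)
  refine ⟨(volume.restrict (Ioc 0 (2 * Real.pi))).withDensity fun θ => ‖v θ‖ₑ ^ 2, ?_, ?_, ?_⟩
  · refine isFiniteMeasure_withDensity ?_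
    rw [← eLpNorm_two_sq]
    exact ENNReal.pow_ne_top hv.2.ne
  · exact (withDensity_absolutelyContinuous _ _).trans Measure.restrict_le_self.absolutelyContinuous
  · intro a b ha hb
    have hS : Icc a b ⊆ Ioc 0 (2 * Real.pi) := fun x hx =>
      ⟨ha.trans_le hx.1, hx.2.trans hb.le⟩
    rw [withDensity_apply _ measurableSet_Icc, Measure.restrict_restrict measurableSet_Icc,
      inter_eq_left.2 hS]
    rcases lt_or_ge b a with hab | hab
    · simp [Icc_eq_empty_of_lt hab]
    refine eVariationOn_le_of_hardy (φr := fun r θ => γ (r * circlePoint θ))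
      (qr := fun r θ => q (r * circlePoint θ)) hS ?_ ?_ ?_ hv.1 hvt
    · intro θ
      have h1 : ContinuousWithinAt γ (Metric.closedBall 0 1) (circlePoint θ) :=
        hc _ (by simp [norm_circlePoint])
      refine h1.tendsto.comp (tendsto_nhdsWithin_iff.2 ⟨?_, ?_⟩)
      · have h2 : Continuous fun r : ℝ => (r : ℂ) * circlePoint θ := by fun_prop
        have h3 := (h2.tendsto 1).mono_left (nhdsWithin_le_nhds (s := Iio 1))
        simpa using h3
      · filter_upwards [hIoo] with r hr
        exact Metric.ball_subset_closedBall (hball r hr θ)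
    · filter_upwards [hIoo] with r hr using hcirc r hr hqd
    · filter_upwards [hIoo] with r hr
      refine (eVariationOn_le_lintegral_enorm hab (hder r hr) (hcont r hr)).trans ?_
      refine lintegral_mono fun θ => ?_
      rw [hnorm r hr]
      exact mul_le_of_le_one_left (zero_le) (ENNReal.ofReal_le_one.2 hr.2.le)

/-! ### Null sets on the circle and on the curve -/

theorem injOn_circlePoint : InjOn circlePoint (Ico 0 (2 * Real.pi)) := by
  intro x hx y hy hxy
  have h1 : circlePoint (x - y) * circlePoint y = circlePoint y := by
    rw [← circlePoint_add, sub_add_cancel, hxy]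
  have h0 : circlePoint y ≠ 0 := norm_ne_zero_iff.1 (by rw [norm_circlePoint]; exact one_ne_zero)
  have h2 : circlePoint (x - y) = 1 := by simpa [h0] using h1
  have h3 : Real.cos (x - y) = 1 := by rw [← circlePoint_re, h2, Complex.one_re]
  have h4 := (Real.cos_eq_one_iff_of_lt_of_lt (by linarith [hx.1, hy.2])
    (by linarith [hx.2, hy.1])).1 h3
  exact sub_eq_zero.1 h4

theorem range_circlePoint : range circlePoint = Metric.sphere 0 1 := by
  ext z
  constructor
  · rintro ⟨θ, rfl⟩
    simp [norm_circlePoint]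
  · intro hz
    have hz1 : ‖z‖ = 1 := by simpa using hz
    refine ⟨z.arg, ?_⟩
    have := Complex.norm_mul_exp_arg_mul_I z
    rwa [hz1, Complex.ofReal_one, one_mul] at this

/-- The angle is an absolutely continuous function of the arc length: preimages of null sets
are null. -/
theorem volume_preimage_eq_zero {c φ : ℝ → ℂ} (hc : HasUnitSpeedOn c univ) {τ : ℝ → ℝ}
    {l l' α β : ℝ} (hbij : BijOn τ (Ioo l l') (Ioo α β)) (hτ : ∀ x ∈ Ioo l l', φ (τ x) = c x)
    (hmono : StrictMonoOn τ (Ioo l l') ∨ StrictAntiOn τ (Ioo l l'))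
    {μ : Measure ℝ} [IsFiniteMeasure μ] (hμ : μ ≪ volume)
    (hle : ∀ a b, α < a → b < β → eVariationOn φ (Icc a b) ≤ μ (Icc a b))
    {E : Set ℝ} (hE : volume E = 0) : volume (τ ⁻¹' E ∩ Ioo l l') = 0 := by
  have hτm : AEMeasurable τ (volume.restrict (Ioo l l')) := by
    rcases hmono with h | h
    · exact aemeasurable_restrict_of_monotoneOn measurableSet_Ioo h.monotoneOn
    · exact aemeasurable_restrict_of_antitoneOn measurableSet_Ioo h.antitoneOn
  have : IsFiniteMeasure (volume.restrict (Ioo l l')) :=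
    isFiniteMeasure_restrict.2 measure_Ioo_lt_top.ne
  -- The pushforward of arc length to the angle is compared with `μ` on small intervals, where it is
  -- at most the variation of `φ`, and then on arbitrary sets by covering.
  have h1 : Measure.map τ (volume.restrict (Ioo l l')) (E ∩ Ioo α β) ≤ μ (E ∩ Ioo α β) := by
    refine measure_le_of_eventually_closedBall_le fun x hx => ?_
    have h2 : ∀ᶠ r in 𝓝[>] (0 : ℝ), r < x - α ∧ r < β - x := by
      have := hx.2
      refine nhdsWithin_le_nhds ((eventually_lt_nhds ?_).and (eventually_lt_nhds ?_))
      · linarith [this.1]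
      · linarith [this.2]
    filter_upwards [h2, self_mem_nhdsWithin] with r hr hr0
    have hr0' : 0 < r := hr0
    rw [Real.closedBall_eq_Icc, Measure.map_apply_of_aemeasurable hτm measurableSet_Icc,
      Measure.restrict_apply' measurableSet_Ioo]
    refine (volume_preimage_le_eVariationOn hc hbij hτ hmono ?_ ?_).trans (hle _ _ ?_ ?_)
    · exact ⟨by linarith [hr.1], by linarith [hr.2]⟩
    · exact ⟨by linarith [hr.1], by linarith [hr.2]⟩
    · linarith [hr.1]
    · linarith [hr.2]
  have h3 : μ (E ∩ Ioo α β) = 0 := measure_mono_null inter_subset_left (hμ hE)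
  have h4 := (Measure.le_map_apply hτm (E ∩ Ioo α β)).trans h1
  rw [h3, Measure.restrict_apply' measurableSet_Ioo] at h4
  refine measure_mono_null ?_ (le_zero_iff.1 h4)
  exact fun x hx => ⟨⟨hx.1, hbij.1 hx.2⟩, hx.2⟩

theorem ae_of_periodic {P : ℝ → Prop} {L : ℝ} (hL : 0 < L) (hP : Function.Periodic P L) {l : ℝ}
    (h : volume ({x | ¬ P x} ∩ Ioo l (l + L)) = 0) : ∀ᵐ x, P x := by
  have h1 : volume ({x | ¬ P x} ∩ Ico l (l + L)) = 0 := by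
    refine measure_mono_null (t := {x | ¬ P x} ∩ Ioo l (l + L) ∪ {l}) ?_ ?_
    · rintro x ⟨hx, hx1, hx2⟩
      rcases hx1.eq_or_lt with h | h
      · exact Or.inr h.symm
      · exact Or.inl ⟨hx, h, hx2⟩
    · exact measure_union_null h (by simp)
  have h2 : {x | ¬ P x} ⊆ ⋃ n : ℤ, (fun x => x + n • L) ⁻¹' ({x | ¬ P x} ∩ Ico l (l + L)) := by
    intro x hx
    obtain ⟨n, hn, -⟩ := existsUnique_add_zsmul_mem_Ico hL x l
    refine mem_iUnion.2 ⟨n, ?_, hn⟩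
    have : P (x + n • L) = P x := hP.zsmul n x
    simpa only [mem_ofPred_eq, this] using hx
  refine measure_mono_null h2 (measure_iUnion_null fun n => ?_)
  rw [measure_preimage_add_right, h1]

/-- The arc-length null sets of a rectifiable curve correspond to the null sets of the circle, in
the direction from the circle to the curve. -/
theorem ae_forall_of_ae {c : ℝ → ℂ} {L : ℝ} (hc : IsSimpleClosedCurve c L) {γ : ℂ → ℂ}
    (hγ : IsConformalTransformation γ (range c)) {P : ℂ → Prop} (hP : ∀ᵐ θ, P (circlePoint θ)) :
    ∀ᵐ l, ∀ θ, γ (circlePoint θ) = c l → P (circlePoint θ) := by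
  have hL := hc.length_pos
  have hcc := continuous_of_hasUnitSpeedOn hc.unit_speed
  have hmem : ∀ θ, circlePoint θ ∈ Metric.closedBall (0 : ℂ) 1 := fun θ => by
    simp [norm_circlePoint]
  have hΦc : Continuous fun θ => γ (circlePoint θ) :=
    hγ.continuousOn.comp_continuous continuous_circlePoint hmem
  have hΦp : Function.Periodic (fun θ => γ (circlePoint θ)) (2 * Real.pi) :=
    circlePoint_periodic.comp γ
  have hΦi : InjOn (fun θ => γ (circlePoint θ)) (Ico 0 (2 * Real.pi)) := fun x hx y hy hxy =>
    injOn_circlePoint hx hy (hγ.injOn (hmem x) (hmem y) hxy)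
  have hr : range c = range fun θ => γ (circlePoint θ) := by
    rw [← hγ.image_sphere, ← range_circlePoint, ← range_comp]
    rfl
  have hrep := exists_reparametrization hL Real.two_pi_pos hcc hΦc hc.periodic hΦp hc.simple hΦi hr
  have hvar : ∀ α, eVariationOn (fun θ => γ (circlePoint θ)) (Icc α (α + 2 * Real.pi)) ≤
      ENNReal.ofReal L := by
    intro α
    obtain ⟨l, τ, -, hbij, hτ, hmono⟩ := hrep α
    rw [eVariationOn_Icc_eq_Ioo (by linarith [Real.two_pi_pos]) hΦc.continuousOn, ← hbij.image_eq,
      eVariationOn_image_eq hτ hmono Subset.rfl]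
    refine (eVariationOn.mono c Ioo_subset_Icc_self).trans ?_
    rw [eVariationOn_Icc_of_hasUnitSpeedOn hc.unit_speed, add_sub_cancel_left]
  obtain ⟨μ, hμf, hμ, hle⟩ := exists_measure_eVariationOn_le hγ.differentiableOn hγ.continuousOn
    (hγ.injOn.mono Metric.ball_subset_closedBall) hL.le hvar
  -- One base point suffices here: the single omitted point per period is null.
  obtain ⟨l, τ, -, hbij, hτ, hmono⟩ := hrep 0
  have hnull := volume_preimage_eq_zero hc.unit_speed hbij hτ hmono hμ
    (fun a b ha hb => hle a b ha (by rwa [zero_add] at hb)) (ae_iff.1 hP)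
  refine ae_of_periodic hL (fun x => ?_) (measure_mono_null ?_ hnull) (l := l)
  · simp only [hc.periodic x]
  · rintro x ⟨hx, hxI⟩
    refine ⟨fun h => hx fun θ hθ => ?_, hxI⟩
    have h1 : γ (circlePoint θ) = γ (circlePoint (τ x)) := hθ.trans (hτ x hxI).symm
    rw [hγ.injOn (hmem _) (hmem _) h1]
    exact h

end PlaneDirichlet

theorem theorem6
    -- the curve, with finitely many points of non-differentiability
    (c : ℝ → ℂ) (L : ℝ) (hc : PlaneDirichlet.IsSimpleClosedCurve c L)
    (hcorner : {l ∈ Set.Ico 0 L | ¬ DifferentiableAt ℝ c l}.Finite)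
    -- the conformal transformation from the unit disk
    (γ : ℂ → ℂ) (hγ : PlaneDirichlet.IsConformalTransformation γ (Set.range c))
    -- the boundary values, a real function on the curve
    (f : ℂ → ℝ) (hf : PlaneDirichlet.LocallyIntegrableAE (fun l => f (c l)) L)
    -- the corresponding inner analytic function on the unit disk
    (w : ℂ → ℂ)
    (hw : PlaneDirichlet.IsCorrespondingInner w
      (fun θ => f (γ (PlaneDirichlet.circlePoint θ))))
    (hfin : {ζ | PlaneDirichlet.IsHardSingularity w ζ}.Finite)
    (hdeg : ∀ ζ, PlaneDirichlet.IsHardSingularity w ζ →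
      ∃ n, PlaneDirichlet.HasDegreeOfHardness w ζ n)
    -- the function does not diverge to infinity at a corner
    (hdiv : ∀ l, ¬ DifferentiableAt ℝ c l → ¬ PlaneDirichlet.DivergesAt (fun s => f (c s)) l) :
    ∃ u : ℂ → ℝ,
      InnerProductSpace.HarmonicOnNhd u (PlaneDirichlet.inside (Set.range c)) ∧
      ∀ᵐ l : ℝ, ∀ θ : ℝ, γ (PlaneDirichlet.circlePoint θ) = c l →
        Filter.Tendsto (fun ρ : ℝ => u (γ ((ρ : ℂ) * PlaneDirichlet.circlePoint θ)))
          (nhdsWithin 1 (Set.Iio 1)) (nhds (f (c l))) := by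
  have hper : Function.Periodic (fun θ => f (γ (PlaneDirichlet.circlePoint θ))) (2 * Real.pi) :=
    PlaneDirichlet.circlePoint_periodic.comp fun z => f (γ z)
  have hlim := PlaneDirichlet.ae_tendsto_re_of_isCorrespondingInner hper hw
  have hwd : DifferentiableOn ℂ w (Metric.ball 0 1) := by
    obtain ⟨-, n, G, -, -, hG, hEq⟩ := hw
    exact (PlaneDirichlet.differentiableOn_iterate_angularDeriv hG n).congr hEq
  obtain ⟨u, hu, huw⟩ := PlaneDirichlet.exists_harmonicOnNhd_comp_eq Metric.isOpen_ball
    hγ.differentiableOn (hγ.injOn.mono Metric.ball_subset_closedBall) hwd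
  refine ⟨u, hγ.image_ball ▸ hu, ?_⟩
  have h := PlaneDirichlet.ae_forall_of_ae hc hγ
    -- The property depends only on the boundary point `z`, so it transfers along the curve; on the
    -- radius `w` is then replaced by `u ∘ γ`.
    (P := fun z => Tendsto (fun ρ : ℝ => (w (ρ * z)).re) (𝓝[<] 1) (𝓝 (f (γ z)))) hlim
  filter_upwards [h] with l hl θ hθ
  rw [← hθ]
  refine (hl θ hθ).congr' ?_
  filter_upwards [Ioo_mem_nhdsLT (show (0 : ℝ) < 1 by norm_num)] with ρ hρ
  exact (huw _ (PlaneDirichlet.ofReal_mul_circlePoint_mem_ball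
    (by rw [abs_of_pos hρ.1]; exact hρ.2) θ)).symm
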